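/- Let $a,b,q$ be real constants, let $f$ be a smooth nowhere zero real function on an open set $V\subseteq\mathbb R^2$, and let $M$ be a nonempty open set of points $(t,r,x^3,x^4)\in\mathbb R^4$ with $r\neq 0$ and $(x^3,x^4)\in V$. Equip $M$ with the Robinson–Trautman metric of Petrov type II $$ds^2=-2\left(a-2br-\tfrac qr\right)dt^2+2\,dt\,dr-\frac{r^2}{f^2}\left[(dx^3)^2+(dx^4)^2\right],\qquad f=f(x^3,x^4),$$ and put $F=f_3^2+f_4^2-f(f_{33}+f_{44})$, where lower indices of $f$ and $F$ denote partial derivatives with respect to $x^3,x^4$. **Notation** (dimension $n=4$). $\nabla$ is the Levi-Civita connection, $R(X_1,X_2,X_3,X_4)=g(\mathcal R(X_1,X_2)X_3,X_4)$ with $\mathcal R(X,Y)=\nabla_{[X,Y]}-[\nabla_X,\nabla_Y]$, $S_{jk}=g^{il}R_{ijkl}$ is the Ricci tensor and $\kappa=g^{jk}S_{jk}$ the scalar curvature. For symmetric $(0,2)$-tensors $A,E$, $$(A\wedge E)(X_1,X_2,X_3,X_4)=A(X_1,X_4)E(X_2,X_3)+A(X_2,X_3)E(X_1,X_4)-A(X_1,X_3)E(X_2,X_4)-A(X_2,X_4)E(X_1,X_3).$$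 The conformal, concircular, conharmonic and projective curvature tensors are $C=R-\frac12 g\wedge S+\frac{\kappa}{12}g\wedge g$, $W=R-\frac{\kappa}{24}g\wedge g$, $K=R-\frac12 g\wedge S$ and $P(X_1,X_2,X_3,X_4)=R(X_1,X_2,X_3,X_4)-\frac13[g(X_1,X_4)S(X_2,X_3)-g(X_2,X_4)S(X_1,X_3)]$. For a $(0,4)$-tensor $D$ with $D(X_1,X_2,X_3,X_4)=g(\mathcal D(X_1,X_2)X_3,X_4)$, a symmetric $(0,2)$-tensor $A$ and a $(0,k)$-tensor $H$, $$(D\cdot H)(X_1,\dots,X_k,X,Y)=-\sum_{i=1}^kH(X_1,\dots,\mathcal D(X,Y)X_i,\dots,X_k),$$ $$Q(A,H)(X_1,\dots,X_k,X,Y)=\sum_{i=1}^k\big[A(X,X_i)H(X_1,\dots,Y,\dots,X_k)-A(Y,X_i)H(X_1,\dots,X,\dots,X_k)\big]$$ ($Y$, resp. $X$, in the $i$-th place). One-forms are written by their components with respect to $(dt,dr,dx^3,dx^4)$, and $\langle\Pi,\Phi\rangle=g^{ij}\Pi_i\Phi_j$, $\|\Pi\|=\langle\Pi,\Pi\rangle$.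 **Theorem.** The following hold on $M$. (i) $R\cdot H=\frac{q-2br^2}{r^3}\,Q(g,H)$ for $H=R$ (Deszcz pseudosymmetry) and hence for $H=S,C,P,W,K$ (Ricci, conformal, projective, concircular and conharmonic pseudosymmetry). If $(b,q)\neq(0,0)$, the common associated scalar $\frac{q-2br^2}{r^3}$ is non-constant on $M$ (non-constant type). (ii) $r^3(2ar-6q-Fr)\,[R\cdot R-Q(S,R)]=2\,(4aqr+4b^2r^4-12bqr^2-3q^2-2qFr)\,Q(g,C)$. (iii) With $L=-\frac{2ar-6q-Fr}{6r^3}$, $C\cdot H=L\,Q(g,H)$ for $H=R,S,C,W,P,K$. (iv) If $4qr(a-3br)+4b^2r^4-3q^2-2qFr$ is nowhere zero on $M$, then $C\cdot R-R\cdot C=L_1Q(g,R)+L_2Q(S,R)$ with $$L_1=-\frac{(2ar-6q-Fr)\,(2(aq+4b^2r^3-6bqr)-qF)}{3r^2\,(4qr(a-3br)+4b^2r^4-3q^2-2qFr)},\qquad L_2=\frac{(q-2br^2)(-2ar+6q+Fr)}{8qr(3br-a)-8b^2r^4+6q^2+4qFr}.$$ (v) $C\cdot R-R\cdot C=L_1Q(g,C)+L_2Q(S,C)$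 with $L_1=\frac{2(-2a+12br+F)}{3r^2}$ and $L_2=1$. (vi) If $-2ar+6q+Fr$ is nowhere zero on $M$, then the conformal curvature 2-forms $\Omega^m_l=C_{jkl}{}^m\,dx^j\wedge dx^k$ are recurrent, i.e. $\mathcal D\Omega^m_l=\Pi\wedge\Omega^m_l$ with $\mathcal D$ the exterior covariant derivative, for $$\Pi=\left\{0,\ \tfrac{F-2a}{-2ar+6q+Fr},\ \tfrac{F_3r}{-2ar+6q+Fr},\ \tfrac{F_4r}{-2ar+6q+Fr}\right\};$$ also, with sums over the cyclic permutations of $(X_1,X_2,X_3)$, $\sum_{\rm cyc}(\nabla_{X_1}C)(X_2,X_3,X,Y)=\sum_{\rm cyc}\Pi(X_1)\,C(X_2,X_3,X,Y)$. (vii) If $-2a+4br+F$ is nowhere zero on $M$, the metric is of Roter type: $R=N_1(S\wedge S)+N_2(g\wedge S)+N_3(g\wedge g)$ with the smooth functions $$N_1=\frac{r(2ar-6q-Fr)}{2(-2a+4br+F)^2},\qquad N_2=\frac{4abr^2+6aq+8b^2r^3-F(2br^2+3q)-36bqr}{r(-2a+4br+F)^2},$$ $$N_3=-\frac1{r^3}\left[-\frac{4br\,(6aq+8b^2r^3-24bqr-3qF)}{(-2a+4br+F)^2}+q\right].$$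 (viii) The metric is 2-quasi-Einstein: for $\alpha=\frac{2a-8br-F}{r^2}$ and also for $\alpha=-\frac{4b}r$ the rank of $S-\alpha g$ is at most $2$ at every point, and it equals $2$ wherever $-2a+4br+F\neq0$. (ix) The metric is generalized quasi-Einstein in the sense of Chaki, i.e. $S=\alpha g+\beta\,\Pi\otimes\Pi+\gamma(\Pi\otimes\Phi+\Phi\otimes\Pi)$: for every nowhere zero function $\varphi$ on $M$ this holds with $$\alpha=-\tfrac{-2a+8br+F}{r^2},\quad\beta=\tfrac{4b(-2a+4br+F)}{\varphi^2r},\quad\gamma=-2a+4br+F,\quad\Pi=\{\varphi,0,0,0\},\quad\Phi=\left\{\tfrac{q-ar}{\varphi r^3},\tfrac1{\varphi r^2},0,0\right\},$$ where $\|\Pi\|=0$ and $\|\Phi\|=-\frac{4b}{\varphi^2r^3}$. (x) The metric is generalized quasi-Einstein in the sense of De and Ghosh, i.e. $S=\alpha g+\beta\,\Pi\otimes\Pi+\gamma\,\Phi\otimes\Phi$, with $$\alpha=-\tfrac{4b}r,\quad\beta=\gamma=\tfrac{-2a+4br+F}{r^2},\quad\Pi=\{0,0,\tfrac rf,0\},\quad\Phi=\{0,0,0,\tfrac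 rf\},$$ where $\|\Pi\|=\|\Phi\|=-1$ and $\langle\Pi,\Phi\rangle=0$. (xi) The metric is pseudo quasi-Einstein: for $\Pi=\{0,0,0,\frac rf\}$, $\alpha=\frac{2a-16br-F}{3r^2}$, $\beta=\frac{2(-2a+4br+F)}{3r^2}$, $\gamma=1$ one has $S=\alpha g+\beta\,\Pi\otimes\Pi+\gamma E$ with a trace free $(0,2)$-tensor $E$ such that $E(X,V)=0$ for all $X$, where $V$ is the vector field metrically dual to $\Pi$. For $\alpha=-\frac F{2r^2}$, $\beta=-\frac{4(a-6br)}{r^2}$, $\gamma=1$ and the same $\Pi$, the decomposition holds with a trace free $E$. (xii) Call a symmetric $(0,2)$-tensor $E$, with $E(X,Y)=g(\mathcal EX,Y)$, $D$-compatible if $D(\mathcal EX_1,X,X_2,X_3)+D(\mathcal EX_2,X,X_3,X_1)+D(\mathcal EX_3,X,X_1,X_2)=0$ for all $X,X_1,X_2,X_3$, and a 1-form $\Pi$ $D$-compatible if $\Pi\otimes\Pi$ is. Every symmetric $(0,2)$-tensor with component matrix $$\begin{pmatrix}t_{11}&t_{12}&0&0\\t_{12}&t_{22}&0&0\\0&0&t_{33}&t_{34}\\0&0&t_{34}&t_{44}\end{pmatrix}$$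 with arbitrary scalars $t_{ij}$ is $R$-, $C$-, $W$- and $K$-compatible; in particular $S$ is. Every 1-form $\{s,0,0,0\}$, $\{0,s,0,0\}$, $\{0,0,s,0\}$ or $\{0,0,0,s\}$, $s$ an arbitrary scalar, is $R$- and $C$-compatible. -/

import Mathlib

open scoped ContDiff

noncomputable section

namespace RT

/-- Scalar fields in coordinates on `ℝⁿ`. -/
abbrev Scalar (n : ℕ) := (Fin n → ℝ) → ℝ

/-- Components of a `(0,k)`-tensor at a point. -/
abbrev Tensor (n k : ℕ) := (Fin k → Fin n) → ℝ

/-- Components of a `(0,k)`-tensor field. -/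
abbrev TensorField (n k : ℕ) := (Fin n → ℝ) → Tensor n k

/-- Component matrices of a `(0,2)`-tensor field (for instance a metric). -/
abbrev MatrixField (n : ℕ) := (Fin n → ℝ) → Matrix (Fin n) (Fin n) ℝ

/-- Components of a 1-form. -/
abbrev OneForm (n : ℕ) := (Fin n → ℝ) → Fin n → ℝ

variable {n k : ℕ}

/-- A `(0,2)`-tensor given by its matrix, as a `(0,2)`-tensor in multi-index form. -/
def tensorOfMatrix (A : Matrix (Fin n) (Fin n) ℝ) : Tensor n 2 := fun I => A (I 0) (I 1)

/-- The partial derivative `∂ᵢφ`. -/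
def pd (i : Fin n) (φ : Scalar n) : Scalar n := fun x => fderiv ℝ φ x (Pi.single i 1)

/-- Christoffel symbols `Γᵏᵢⱼ` of the Levi-Civita connection. -/
def christoffel (g : MatrixField n) (k i j : Fin n) : Scalar n := fun x =>
  (1 / 2) * ∑ l, (g x)⁻¹ k l *
    (pd i (fun y => g y j l) x + pd j (fun y => g y i l) x - pd l (fun y => g y i j) x)

/-- The `(1,3)` curvature tensor: the `m`-th component of `R(∂ᵢ,∂ⱼ)∂ₖ`, with the sign convention
`R(X,Y)Z = ∇_{[X,Y]} Z - ∇_X ∇_Y Z + ∇_Y ∇_X Z`. -/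
def curvatureUp (g : MatrixField n) (i j k m : Fin n) : Scalar n := fun x =>
  -(pd i (christoffel g m j k) x - pd j (christoffel g m i k) x
    + ∑ p, (christoffel g m i p x * christoffel g p j k x
            - christoffel g m j p x * christoffel g p i k x))

/-- The Riemann-Christoffel tensor `R(X₁,X₂,X₃,X₄) = g(R(X₁,X₂)X₃,X₄)`. -/
def riemann (g : MatrixField n) : TensorField n 4 := fun x I =>
  ∑ m, g x m (I 3) * curvatureUp g (I 0) (I 1) (I 2) m x

/-- The Ricci tensor `Sⱼₖ = gⁱˡ Rᵢⱼₖₗ`. -/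
def ricci (g : MatrixField n) : MatrixField n := fun x =>
  Matrix.of fun j k => ∑ i, ∑ l, (g x)⁻¹ i l * riemann g x ![i, j, k, l]

/-- The scalar curvature `κ = gʲᵏ Sⱼₖ`. -/
def scalarCurvature (g : MatrixField n) : Scalar n := fun x =>
  ∑ j, ∑ k, (g x)⁻¹ j k * ricci g x j k

/-- The Kulkarni-Nomizu product `A ∧ E` of two `(0,2)`-tensors. -/
def kn (A E : Matrix (Fin n) (Fin n) ℝ) : Tensor n 4 := fun I =>
  A (I 0) (I 3) * E (I 1) (I 2) + A (I 1) (I 2) * E (I 0) (I 3)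
    - A (I 0) (I 2) * E (I 1) (I 3) - A (I 1) (I 3) * E (I 0) (I 2)

/-- The conformal (Weyl) curvature tensor `C`. -/
def conformal (g : MatrixField n) : TensorField n 4 := fun x =>
  riemann g x - (1 / ((n : ℝ) - 2)) • kn (g x) (ricci g x)
    + (scalarCurvature g x / (2 * ((n : ℝ) - 2) * ((n : ℝ) - 1))) • kn (g x) (g x)

/-- The concircular curvature tensor `W`. -/
def concircular (g : MatrixField n) : TensorField n 4 := fun x =>
  riemann g x - (scalarCurvature g x / (2 * (n : ℝ) * ((n : ℝ) - 1))) • kn (g x) (g x)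

/-- The conharmonic curvature tensor `K`. -/
def conharmonic (g : MatrixField n) : TensorField n 4 := fun x =>
  riemann g x - (1 / ((n : ℝ) - 2)) • kn (g x) (ricci g x)

/-- The projective curvature tensor `P`. -/
def projective (g : MatrixField n) : TensorField n 4 := fun x I =>
  riemann g x I - (1 / ((n : ℝ) - 1)) *
    (g x (I 0) (I 3) * ricci g x (I 1) (I 2) - g x (I 1) (I 3) * ricci g x (I 0) (I 2))

/-- `(D · H)(X₁,…,Xₖ,X,Y) = - ∑ₐ H(X₁,…,𝒟(X,Y)Xₐ,…,Xₖ)` on coordinate fields, where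
`D(X,Y,Z,V) = g(𝒟(X,Y)Z,V)`; `I` lists `X₁,…,Xₖ` and the last two arguments are `X`, `Y`. -/
def dot (g : Matrix (Fin n) (Fin n) ℝ) (D : Tensor n 4) (H : Tensor n k) :
    (Fin k → Fin n) → Fin n → Fin n → ℝ := fun I X Y =>
  -∑ a, ∑ p, (∑ q, g⁻¹ p q * D ![X, Y, I a, q]) * H (Function.update I a p)

/-- The Tachibana tensor
`Q(A,H)(X₁,…,Xₖ,X,Y) = ∑ₐ (A(X,Xₐ) H(X₁,…,Y,…,Xₖ) - A(Y,Xₐ) H(X₁,…,X,…,Xₖ))`. -/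
def tachibana (A : Matrix (Fin n) (Fin n) ℝ) (H : Tensor n k) :
    (Fin k → Fin n) → Fin n → Fin n → ℝ := fun I X Y =>
  ∑ a, (A X (I a) * H (Function.update I a Y) - A Y (I a) * H (Function.update I a X))

/-- `D · H = L Q(g,H)` on `M`. -/
def IsPseudosymmetric (M : Set (Fin n → ℝ)) (g : MatrixField n) (D : TensorField n 4)
    (H : TensorField n k) (L : Scalar n) : Prop :=
  ∀ x ∈ M, dot (g x) (D x) (H x) = L x • tachibana (g x) (H x)

/-- Components `(∇ᵢ H)_I` of the covariant derivative of a `(0,k)`-tensor field. -/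
def covDeriv (g : MatrixField n) (H : TensorField n k) (i : Fin n) : TensorField n k := fun x I =>
  pd i (fun y => H y I) x
    - ∑ a, ∑ p, christoffel g p i (I a) x * H x (Function.update I a p)

/-- Coefficients `D_{jkl}^m` of the curvature 2-forms `Ω_l^m = D_{jkl}^m dx^j ∧ dx^k`. -/
def curvatureForm (g : MatrixField n) (D : TensorField n 4) (j k l m : Fin n) : Scalar n :=
  fun x => ∑ p, (g x)⁻¹ m p * D x ![j, k, l, p]

/-- Coefficient of `dx^i` in `∂_i Ω + ω_i Ω - Ω ω_i`, where `ω^m_p = Γ^m_{ip} dx^i` is the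
connection form. -/
def connDeriv (g : MatrixField n) (D : TensorField n 4) (i j k l m : Fin n) : Scalar n := fun x =>
  pd i (curvatureForm g D j k l m) x
    + ∑ p, (christoffel g m i p x * curvatureForm g D j k l p x
            - christoffel g p i l x * curvatureForm g D j k p m x)

/-- Recurrence of the curvature 2-forms of a generalized curvature tensor `D`:
`𝒟 Ω_l^m = η ∧ Ω_l^m`, where `𝒟 Ω = dΩ + ω ∧ Ω - Ω ∧ ω` is the exterior (covariant) derivative
with respect to the Levi-Civita connection. As `D` is skew in its first two arguments, the equality
of 3-forms is the equality of the cyclic sums over `i, j, k` of their coefficients. -/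
def IsRecurrentForm (M : Set (Fin n → ℝ)) (g : MatrixField n) (D : TensorField n 4)
    (η : OneForm n) : Prop :=
  ∀ x ∈ M, ∀ i j k l m : Fin n,
    connDeriv g D i j k l m x + connDeriv g D j k i l m x + connDeriv g D k i j l m x
      = η x i * curvatureForm g D j k l m x + η x j * curvatureForm g D k i l m x
        + η x k * curvatureForm g D i j l m x

/-- The cyclic identity
`∑_cyc (∇_{X₁} D)(X₂,X₃,X,Y) = ∑_cyc η(X₁) D(X₂,X₃,X,Y)`. -/
def SatisfiesCyclicRecurrence (M : Set (Fin n → ℝ)) (g : MatrixField n) (D : TensorField n 4)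
    (η : OneForm n) : Prop :=
  ∀ x ∈ M, ∀ i j k l m : Fin n,
    covDeriv g D i x ![j, k, l, m] + covDeriv g D j x ![k, i, l, m]
        + covDeriv g D k x ![i, j, l, m]
      = η x i * D x ![j, k, l, m] + η x j * D x ![k, i, l, m] + η x k * D x ![i, j, l, m]

/-- Roter type: `R = N₁ (S ∧ S) + N₂ (g ∧ S) + N₃ (g ∧ g)` with smooth coefficients. -/
def IsRoterType (M : Set (Fin n → ℝ)) (g : MatrixField n) (N₁ N₂ N₃ : Scalar n) : Prop :=
  ContDiffOn ℝ ∞ N₁ M ∧ ContDiffOn ℝ ∞ N₂ M ∧ ContDiffOn ℝ ∞ N₃ M ∧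
  ∀ x ∈ M, riemann g x = N₁ x • kn (ricci g x) (ricci g x) + N₂ x • kn (g x) (ricci g x)
    + N₃ x • kn (g x) (g x)

/-- 2-quasi-Einstein with respect to the scalar `α`. -/
def IsTwoQuasiEinstein (M : Set (Fin n → ℝ)) (g : MatrixField n) (α : Scalar n) : Prop :=
  ∀ x ∈ M, (ricci g x - α x • g x).rank ≤ 2

/-- `g(η,θ) = gⁱʲ ηᵢ θⱼ` for two 1-forms. -/
def formInner (g : MatrixField n) (η θ : OneForm n) : Scalar n := fun x =>
  ∑ i, ∑ j, (g x)⁻¹ i j * η x i * θ x j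

/-- `S = α g + β η ⊗ η + γ (η ⊗ θ + θ ⊗ η)` on `M`. -/
def IsChakiQuasiEinstein (M : Set (Fin n → ℝ)) (g : MatrixField n) (α β γ : Scalar n)
    (η θ : OneForm n) : Prop :=
  ∀ x ∈ M, ∀ i j, ricci g x i j = α x * g x i j + β x * (η x i * η x j)
    + γ x * (η x i * θ x j + θ x i * η x j)

/-- `S = α g + β η ⊗ η + γ θ ⊗ θ` on `M`. -/
def IsDeGhoshQuasiEinstein (M : Set (Fin n → ℝ)) (g : MatrixField n) (α β γ : Scalar n)
    (η θ : OneForm n) : Prop :=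
  ∀ x ∈ M, ∀ i j, ricci g x i j = α x * g x i j + β x * (η x i * η x j)
    + γ x * (θ x i * θ x j)

/-- `S = α g + β η ⊗ η + γ E` on `M`. -/
def HasQuasiEinsteinForm (M : Set (Fin n → ℝ)) (g : MatrixField n) (α β γ : Scalar n)
    (η : OneForm n) (E : MatrixField n) : Prop :=
  ∀ x ∈ M, ∀ i j, ricci g x i j = α x * g x i j + β x * (η x i * η x j) + γ x * E x i j

/-- The `(0,2)`-tensor `E` is trace free on `M`. -/
def IsTraceFree (M : Set (Fin n → ℝ)) (g : MatrixField n) (E : MatrixField n) : Prop :=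
  ∀ x ∈ M, ∑ i, ∑ j, (g x)⁻¹ i j * E x i j = 0

/-- Pseudo quasi-Einstein: `S = α g + β η ⊗ η + γ E` with `E` trace free and `E(X,V) = 0` for all
`X`, where `V` is the vector field dual to `η`. -/
def IsPseudoQuasiEinstein (M : Set (Fin n → ℝ)) (g : MatrixField n) (α β γ : Scalar n)
    (η : OneForm n) : Prop :=
  ∃ E : MatrixField n, HasQuasiEinsteinForm M g α β γ η E ∧ IsTraceFree M g E ∧
    ∀ x ∈ M, ∀ i, ∑ p, E x i p * (∑ q, (g x)⁻¹ p q * η x q) = 0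

/-- Components `ℰᵖᵢ` of the endomorphism `ℰ` with `E(X,Y) = g(ℰX,Y)`. -/
def endo (g E : Matrix (Fin n) (Fin n) ℝ) (p i : Fin n) : ℝ := ∑ q, g⁻¹ p q * E i q

/-- `E` is `D`-compatible (at a point):
`D(ℰX₁,X,X₂,X₃) + D(ℰX₂,X,X₃,X₁) + D(ℰX₃,X,X₁,X₂) = 0`. -/
def IsCompatible (g : Matrix (Fin n) (Fin n) ℝ) (D : Tensor n 4)
    (E : Matrix (Fin n) (Fin n) ℝ) : Prop :=
  ∀ j X₁ X₂ X₃ : Fin n,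
    ∑ p, endo g E p X₁ * D ![p, j, X₂, X₃] + ∑ p, endo g E p X₂ * D ![p, j, X₃, X₁]
      + ∑ p, endo g E p X₃ * D ![p, j, X₁, X₂] = 0

/-- A 1-form `η` is `D`-compatible if `η ⊗ η` is. -/
def IsFormCompatible (g : Matrix (Fin n) (Fin n) ℝ) (D : Tensor n 4) (η : Fin n → ℝ) : Prop :=
  IsCompatible g D (Matrix.vecMulVec η η)

/-- The Robinson-Trautman metric of Petrov type II in the coordinates
`(t, r, x³, x⁴) = (x 0, x 1, x 2, x 3)`. -/
def metric (a b q : ℝ) (f : ℝ × ℝ → ℝ) : MatrixField 4 := fun x =>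
  !![-2 * (a - 2 * b * x 1 - q * (x 1)⁻¹), 1, 0, 0;
     1, 0, 0, 0;
     0, 0, -((x 1) ^ 2 / f (x 2, x 3) ^ 2), 0;
     0, 0, 0, -((x 1) ^ 2 / f (x 2, x 3) ^ 2)]

/-- `F = f₃² + f₄² - f (f₃₃ + f₄₄)`, as a function of the four coordinates. -/
def fiberF (f : ℝ × ℝ → ℝ) : Scalar 4 :=
  let φ : Scalar 4 := fun x => f (x 2, x 3)
  fun x => pd 2 φ x ^ 2 + pd 3 φ x ^ 2 - φ x * (pd 2 (pd 2 φ) x + pd 3 (pd 3 φ) x)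

end RT

end

/-!
The metric splits orthogonally as `g = h + p`, with `h` the restriction to the `(t, r)`-planes and
`p` the restriction to the `(x³, x⁴)`-planes; it is a warped product of two surfaces. Therefore its
curvature tensor is a combination

  `R = c₁ h ∧ h + c₂ h ∧ p + c₃ p ∧ p`,  `c₁ = -q / r³`,  `c₂ = (q - 2 b r²) / r³`,
  `c₃ = (2 a r - 4 b r² - F r - 2 q) / (2 r³)`

(`riemann_block`). This is the only substantial computation: the Christoffel symbols and their first
derivatives are tabulated and the components of the curvature are compared one by one
(`curvatureUp_eq`). Contraction shows that `S` is a combination of `h` and `p`, and that `C`, `W`,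
`K` are again combinations of `h ∧ h`, `h ∧ p`, `p ∧ p`. From then on everything happens in this
small algebra.

* For such a tensor `D`, write `D = (c₂ / 2) g ∧ g + (c₁ - c₂ / 2) h ∧ h + (c₃ - c₂ / 2) p ∧ p`.
  The endomorphisms of `h ∧ h` and `p ∧ p` are skew on one block and vanish on the other, so they
  annihilate `h`, `p` and all tensors built from them, while `g ∧ g` acts as `2 Q(g, ·)`. Hence
  `D · H = c₂ Q(g, H)` for every such `H` (`IsSplitting.dot_blockTensor`), which gives all
  pseudosymmetries.
* The identity `Q(E, A ∧ A) = -2 Q(A, A ∧ E)` (`tachibana_kn_self`) expresses every `Q(A, D)` by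
  `Q(h, h ∧ p)` and `Q(p, h ∧ p)`, so the relations between `C · R`, `R · C`, `Q(g, ·)` and
  `Q(S, ·)` become identities between two pairs of rational functions.
* A symmetric tensor preserving the two blocks is compatible with `g ∧ g`, `h ∧ h` and `p ∧ p`
  (`IsSplitting.isCompatible_blockTensor`).
* Since `S` and `g` are combinations of `h` and `p`, the Roter equation and the quasi-Einstein
  decompositions are comparisons of coefficients, and the ranks are those of multiples of `h`
  and `p`.
* The conformal tensor is `w (h ∧ p - h ∧ h - p ∧ p)` with
  `w = (-2 a r + 6 q + F r) / (6 r³)`, and `∇ᵢ h = pᵢ ⊗ dr/r + dr/r ⊗ pᵢ = -∇ᵢ p`. The cyclic sum of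
  `∇ (h ∧ p - h ∧ h - p ∧ p)` is therefore that of `3 dr/r` times this tensor (`cyclic_weylShape`);
  here it matters that the `(t, r)`-block is two-dimensional. As `dw = w (Π - 3 dr/r)` for
  `Π = d log |-2 a r + 6 q + F r|`, the recurrence follows (`conformal_cyclicRecurrence`).
-/

noncomputable section

namespace RT

section

variable {n k : ℕ}

/-! ### Endomorphisms acting as derivations on tensors -/

/-- The derivation `H ↦ ∑ₐ H(…,T Xₐ,…)` of the `(0,k)`-tensors induced by the endomorphism `T`
with components `T p i` (`T ∂ᵢ = ∑ₚ T p i ∂ₚ`). No sign is built in. -/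
def act (T : Matrix (Fin n) (Fin n) ℝ) (H : Tensor n k) : Tensor n k := fun I =>
  ∑ a, ∑ p, T p (I a) * H (Function.update I a p)

/-- The components of the endomorphism `𝒟(X,Y)` belonging to a `(0,4)`-tensor `D`. -/
def curvEndo (g : Matrix (Fin n) (Fin n) ℝ) (D : Tensor n 4) (X Y : Fin n) :
    Matrix (Fin n) (Fin n) ℝ := Matrix.of fun p i => ∑ q, g⁻¹ p q * D ![X, Y, i, q]

/-- The components of the endomorphism `Z ↦ A(Y,Z) X - A(X,Z) Y`. -/
def wedgeEndo (A : Matrix (Fin n) (Fin n) ℝ) (X Y : Fin n) : Matrix (Fin n) (Fin n) ℝ :=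
  Matrix.of fun p i => (if p = X then A Y i else 0) - (if p = Y then A X i else 0)

/-- The derivation `act T` on `(0,2)`-tensors in matrix form. -/
def actMat (T A : Matrix (Fin n) (Fin n) ℝ) : Matrix (Fin n) (Fin n) ℝ :=
  T.transpose * A + A * T

/-- The tensor `A(X₁,X₄) E(X₂,X₃) - A(X₂,X₄) E(X₁,X₃)`, one half of the Kulkarni-Nomizu
product. -/
def halfKn (A E : Matrix (Fin n) (Fin n) ℝ) : Tensor n 4 := fun I =>
  A (I 0) (I 3) * E (I 1) (I 2) - A (I 1) (I 3) * E (I 0) (I 2)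

theorem kn_eq_halfKn (A E : Matrix (Fin n) (Fin n) ℝ) : kn A E = halfKn A E + halfKn E A := by
  funext I
  simp only [kn, halfKn, Pi.add_apply]
  ring

/-- `D · H` is the derivation by the endomorphisms `𝒟(X,Y)`, up to sign. -/
theorem dot_eq_act (g : Matrix (Fin n) (Fin n) ℝ) (D : Tensor n 4) (H : Tensor n k)
    (I : Fin k → Fin n) (X Y : Fin n) : dot g D H I X Y = -act (curvEndo g D X Y) H I := rfl

/-- `Q(A,H)` is the derivation by the endomorphisms `X ∧_A Y`, up to sign. -/
theorem tachibana_eq_act (A : Matrix (Fin n) (Fin n) ℝ) (H : Tensor n k)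
    (I : Fin k → Fin n) (X Y : Fin n) : tachibana A H I X Y = -act (wedgeEndo A X Y) H I := by
  simp [tachibana, act, wedgeEndo, sub_mul, Finset.sum_sub_distrib, ite_mul]

theorem act_add_left (T T' : Matrix (Fin n) (Fin n) ℝ) (H : Tensor n k) :
    act (T + T') H = act T H + act T' H := by
  funext I
  simp [act, add_mul, Finset.sum_add_distrib]

theorem act_smul_left (c : ℝ) (T : Matrix (Fin n) (Fin n) ℝ) (H : Tensor n k) :
    act (c • T) H = c • act T H := by
  funext I
  simp [act, mul_assoc, Finset.mul_sum]

theorem act_add_right (T : Matrix (Fin n) (Fin n) ℝ) (H H' : Tensor n k) :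
    act T (H + H') = act T H + act T H' := by
  funext I
  simp [act, mul_add, Finset.sum_add_distrib]

theorem act_smul_right (c : ℝ) (T : Matrix (Fin n) (Fin n) ℝ) (H : Tensor n k) :
    act T (c • H) = c • act T H := by
  funext I
  simp [act, Finset.mul_sum, mul_left_comm]

theorem act_tensorOfMatrix (T A : Matrix (Fin n) (Fin n) ℝ) :
    act T (tensorOfMatrix A) = tensorOfMatrix (actMat T A) := by
  funext I
  simp [act, tensorOfMatrix, actMat, Fin.sum_univ_two, Matrix.mul_apply, mul_comm]

/-- The Leibniz rule for the derivation `act T`. -/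
theorem act_halfKn (T A E : Matrix (Fin n) (Fin n) ℝ) :
    act T (halfKn A E) = halfKn (actMat T A) E + halfKn A (actMat T E) := by
  funext I
  simp only [act, Fin.sum_univ_four, halfKn, actMat, Pi.add_apply, Matrix.add_apply,
    Matrix.mul_apply, Matrix.transpose_apply, Function.update_apply]
  simp only [Fin.isValue, if_true, if_false, Fin.reduceEq, mul_sub,
    Finset.sum_sub_distrib, add_mul, mul_add, Finset.sum_mul, Finset.mul_sum]
  simp only [mul_comm, mul_left_comm, mul_assoc]
  ring

theorem act_kn (T A E : Matrix (Fin n) (Fin n) ℝ) :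
    act T (kn A E) = kn (actMat T A) E + kn A (actMat T E) := by
  simp only [kn_eq_halfKn, act_add_right, act_halfKn]
  abel

theorem actMat_add (T A E : Matrix (Fin n) (Fin n) ℝ) :
    actMat T (A + E) = actMat T A + actMat T E := by
  simp only [actMat, mul_add, add_mul]; abel

theorem actMat_smul (T : Matrix (Fin n) (Fin n) ℝ) (c : ℝ) (A : Matrix (Fin n) (Fin n) ℝ) :
    actMat T (c • A) = c • actMat T A := by
  simp [actMat]

theorem curvEndo_add (g : Matrix (Fin n) (Fin n) ℝ) (D D' : Tensor n 4) (X Y : Fin n) :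
    curvEndo g (D + D') X Y = curvEndo g D X Y + curvEndo g D' X Y := by
  ext p i
  simp [curvEndo, mul_add, Finset.sum_add_distrib]

theorem curvEndo_smul (g : Matrix (Fin n) (Fin n) ℝ) (c : ℝ) (D : Tensor n 4) (X Y : Fin n) :
    curvEndo g (c • D) X Y = c • curvEndo g D X Y := by
  ext p i
  simp [curvEndo, Finset.mul_sum, mul_left_comm]

theorem tachibana_add_left (A B : Matrix (Fin n) (Fin n) ℝ) (H : Tensor n k) :
    tachibana (A + B) H = tachibana A H + tachibana B H := by
  funext I X Y
  simp only [tachibana, Matrix.add_apply, Pi.add_apply, ← Finset.sum_add_distrib]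
  exact Finset.sum_congr rfl fun a _ => by ring

theorem tachibana_smul_left (c : ℝ) (A : Matrix (Fin n) (Fin n) ℝ) (H : Tensor n k) :
    tachibana (c • A) H = c • tachibana A H := by
  funext I X Y
  simp only [tachibana, Matrix.smul_apply, Pi.smul_apply, smul_eq_mul, Finset.mul_sum]
  exact Finset.sum_congr rfl fun a _ => by ring

theorem tachibana_add_right (A : Matrix (Fin n) (Fin n) ℝ) (H H' : Tensor n k) :
    tachibana A (H + H') = tachibana A H + tachibana A H' := by
  funext I X Y
  simp only [tachibana, Pi.add_apply, ← Finset.sum_add_distrib]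
  exact Finset.sum_congr rfl fun a _ => by ring

theorem tachibana_smul_right (A : Matrix (Fin n) (Fin n) ℝ) (c : ℝ) (H : Tensor n k) :
    tachibana A (c • H) = c • tachibana A H := by
  funext I X Y
  simp only [tachibana, Pi.smul_apply, smul_eq_mul, Finset.mul_sum]
  exact Finset.sum_congr rfl fun a _ => by ring

/-- The polarisation of `Q(A, A ∧ A) = 0`, valid in every dimension. It leaves only two independent
Tachibana tensors `Q(A, B ∧ B')` for `A, B, B'` among the two blocks of an orthogonal splitting. -/
theorem tachibana_kn_self {A E : Matrix (Fin n) (Fin n) ℝ} (hA : A.IsSymm) (hE : E.IsSymm) :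
    tachibana E (kn A A) = (-2 : ℝ) • tachibana A (kn A E) := by
  have hA' := hA.apply
  have hE' := hE.apply
  funext I X Y
  simp only [tachibana, Fin.sum_univ_four, kn, Function.update_apply, Pi.smul_apply, smul_eq_mul]
  simp only [Fin.isValue, if_true, if_false, Fin.reduceEq]
  simp only [hA' X, hA' Y, hE' X, hE' Y]
  ring

theorem tachibana_kn_same {A : Matrix (Fin n) (Fin n) ℝ} (hA : A.IsSymm) :
    tachibana A (kn A A) = 0 := by
  have h := tachibana_kn_self hA hA
  funext I X Y
  have h' := congrFun (congrFun (congrFun h I) X) Y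
  simp only [Pi.smul_apply, smul_eq_mul] at h'
  simp only [Pi.zero_apply]
  linarith

theorem kn_comm (A E : Matrix (Fin n) (Fin n) ℝ) : kn A E = kn E A := by
  rw [kn_eq_halfKn, kn_eq_halfKn, add_comm]

theorem kn_add_left (A B E : Matrix (Fin n) (Fin n) ℝ) : kn (A + B) E = kn A E + kn B E := by
  funext I
  simp only [kn, Matrix.add_apply, Pi.add_apply]
  ring

theorem kn_smul_left (c : ℝ) (A E : Matrix (Fin n) (Fin n) ℝ) : kn (c • A) E = c • kn A E := by
  funext I
  simp only [kn, Matrix.smul_apply, Pi.smul_apply, smul_eq_mul]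
  ring

theorem kn_add_right (A B E : Matrix (Fin n) (Fin n) ℝ) : kn E (A + B) = kn E A + kn E B := by
  rw [kn_comm, kn_add_left, kn_comm A, kn_comm B]

theorem kn_smul_right (c : ℝ) (A E : Matrix (Fin n) (Fin n) ℝ) : kn A (c • E) = c • kn A E := by
  rw [kn_comm, kn_smul_left, kn_comm]

theorem kn_zero_left (A : Matrix (Fin n) (Fin n) ℝ) : kn 0 A = 0 := by
  funext I
  simp [kn]

theorem kn_zero_right (A : Matrix (Fin n) (Fin n) ℝ) : kn A 0 = 0 := by
  rw [kn_comm, kn_zero_left]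

theorem halfKn_zero_left (A : Matrix (Fin n) (Fin n) ℝ) : halfKn 0 A = 0 := by
  funext I
  simp [halfKn]

theorem halfKn_zero_right (A : Matrix (Fin n) (Fin n) ℝ) : halfKn A 0 = 0 := by
  funext I
  simp [halfKn]

theorem curvEndo_kn_self_apply (g A : Matrix (Fin n) (Fin n) ℝ) (hA : A.IsSymm) (X Y i l : Fin n) :
    curvEndo g (kn A A) X Y l i
      = 2 * ((g⁻¹ * A) l X * A Y i - A X i * (g⁻¹ * A) l Y) := by
  simp only [curvEndo, Matrix.of_apply, kn, Matrix.mul_apply, Finset.mul_sum, Finset.sum_mul,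
    ← Finset.sum_sub_distrib]
  refine Finset.sum_congr rfl fun q _ => ?_
  simp only [Matrix.cons_val]
  rw [hA.apply X q, hA.apply Y q]
  ring

/-! ### Compatible tensors -/

theorem IsCompatible.add {g : Matrix (Fin n) (Fin n) ℝ} {D D' : Tensor n 4}
    {E : Matrix (Fin n) (Fin n) ℝ}
    (h₁ : IsCompatible g D E) (h₂ : IsCompatible g D' E) : IsCompatible g (D + D') E := by
  intro j a b c
  have e₁ := h₁ j a b c
  have e₂ := h₂ j a b c
  simp only [Pi.add_apply, mul_add, Finset.sum_add_distrib]
  linarith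

theorem IsCompatible.smul {g : Matrix (Fin n) (Fin n) ℝ} {D : Tensor n 4}
    {E : Matrix (Fin n) (Fin n) ℝ}
    (h₁ : IsCompatible g D E) (c : ℝ) : IsCompatible g (c • D) E := by
  intro j a b d
  have e₁ := h₁ j a b d
  simp only [Pi.smul_apply, smul_eq_mul, mul_left_comm _ c, ← Finset.mul_sum]
  rw [← mul_add, ← mul_add, e₁, mul_zero]

/-- `A ∧ A` is compatible with `E` as soon as `A(ℰX,Y)` is symmetric in `X`, `Y`. -/
theorem isCompatible_kn_self {g A E : Matrix (Fin n) (Fin n) ℝ}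
    (hAE : (E * (g⁻¹).transpose * A).IsSymm) : IsCompatible g (kn A A) E := by
  intro j a b c
  have e : ∀ u v, ∑ l, endo g E l u * A l v = (E * (g⁻¹).transpose * A) u v := by
    intro u v
    simp only [Matrix.mul_apply, endo, Matrix.transpose_apply]
    exact Finset.sum_congr rfl fun l _ => by
      rw [Finset.sum_congr rfl fun q _ => mul_comm (g⁻¹ l q) (E u q)]
  have key : ∀ u v w, ∑ l, endo g E l u * kn A A ![l, j, v, w]
      = 2 * ((E * (g⁻¹).transpose * A) u w * A j v - (E * (g⁻¹).transpose * A) u v * A j w) := by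
    intro u v w
    rw [← e, ← e]
    simp only [Finset.mul_sum, Finset.sum_mul, ← Finset.sum_sub_distrib]
    refine Finset.sum_congr rfl fun l _ => ?_
    simp only [kn, Matrix.cons_val]
    ring
  rw [key, key, key, hAE.apply a b, hAE.apply c a, hAE.apply c b]
  ring

/-! ### Tensors built from an orthogonal splitting of the metric -/

/-- `g = h + p` is an orthogonal splitting: `g` is nondegenerate and the symmetric tensors `h`, `p`
are the restrictions of `g` to two complementary orthogonal subspaces. -/
structure IsSplitting (g h p : Matrix (Fin n) (Fin n) ℝ) : Prop where
  symm_left : h.IsSymm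
  symm_right : p.IsSymm
  add_eq : g = h + p
  isUnit_det : IsUnit g.det
  left_left : h * g⁻¹ * h = h
  left_right : h * g⁻¹ * p = 0

/-- The curvature-like tensor `c₁ h ∧ h + c₂ h ∧ p + c₃ p ∧ p`. -/
def blockTensor (h p : Matrix (Fin n) (Fin n) ℝ) (c₁ c₂ c₃ : ℝ) : Tensor n 4 :=
  c₁ • kn h h + c₂ • kn h p + c₃ • kn p p

namespace IsSplitting

variable {g h p : Matrix (Fin n) (Fin n) ℝ}

theorem symm (s : IsSplitting g h p) : g.IsSymm := by
  rw [s.add_eq]; exact s.symm_left.add s.symm_right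

theorem inv_symm (s : IsSplitting g h p) : (g⁻¹).IsSymm := by
  have h1 := s.symm
  unfold Matrix.IsSymm at *
  rw [Matrix.transpose_nonsing_inv, h1]

theorem right_left (s : IsSplitting g h p) : p * g⁻¹ * h = 0 := by
  have := congrArg Matrix.transpose s.left_right
  rwa [Matrix.transpose_mul, Matrix.transpose_mul, s.inv_symm.eq, s.symm_left.eq, s.symm_right.eq,
    Matrix.transpose_zero, ← mul_assoc] at this

theorem right_right (s : IsSplitting g h p) : p * g⁻¹ * p = p := by
  have h1 : p * g⁻¹ * (h + p) = p := by
    rw [← s.add_eq, mul_assoc, Matrix.nonsing_inv_mul _ s.isUnit_det, mul_one]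
  rwa [mul_add, s.right_left, zero_add] at h1

theorem swap (s : IsSplitting g h p) : IsSplitting g p h :=
  ⟨s.symm_right, s.symm_left, by rw [s.add_eq, add_comm], s.isUnit_det, s.right_right,
    s.right_left⟩

theorem curvEndo_kn_metric (s : IsSplitting g h p) (X Y : Fin n) :
    curvEndo g (kn g g) X Y = (2 : ℝ) • wedgeEndo g X Y := by
  ext l i
  rw [curvEndo_kn_self_apply g g s.symm, Matrix.nonsing_inv_mul _ s.isUnit_det]
  simp [wedgeEndo, Matrix.one_apply, ite_mul, mul_ite]

theorem actMat_curvEndo_self (s : IsSplitting g h p) (X Y : Fin n) :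
    actMat (curvEndo g (kn h h) X Y) h = 0 := by
  have key : ∀ i j, (∑ l, curvEndo g (kn h h) X Y l i * h j l)
      = 2 * (h j X * h Y i - h X i * h j Y) := by
    intro i j
    have e : ∀ Z, ∑ l, (g⁻¹ * h) l Z * h j l = h j Z := by
      intro Z
      have := congrFun (congrFun s.left_left j) Z
      rw [mul_assoc, Matrix.mul_apply] at this
      simpa only [mul_comm] using this
    simp only [curvEndo_kn_self_apply g h s.symm_left]
    rw [← e X, ← e Y]
    simp only [Finset.mul_sum, Finset.sum_mul, ← Finset.sum_sub_distrib]
    exact Finset.sum_congr rfl fun l _ => by ring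
  ext i j
  simp only [actMat, Matrix.add_apply, Matrix.mul_apply, Matrix.transpose_apply, Matrix.zero_apply]
  have h1 : ∀ l, h l j = h j l := fun l => s.symm_left.apply j l
  simp only [h1, key]
  rw [Finset.sum_congr rfl fun l _ => mul_comm (h i l) _, key, s.symm_left.apply X j,
    s.symm_left.apply X i, s.symm_left.apply Y i, s.symm_left.apply Y j]
  ring

theorem actMat_curvEndo_other (s : IsSplitting g h p) (X Y : Fin n) :
    actMat (curvEndo g (kn h h) X Y) p = 0 := by
  have key : ∀ i j, (∑ l, curvEndo g (kn h h) X Y l i * p j l) = 0 := by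
    intro i j
    have e : ∀ Z, ∑ l, (g⁻¹ * h) l Z * p j l = 0 := by
      intro Z
      have := congrFun (congrFun s.right_left j) Z
      rw [mul_assoc, Matrix.mul_apply, Matrix.zero_apply] at this
      simpa only [mul_comm] using this
    simp only [curvEndo_kn_self_apply g h s.symm_left]
    have : (0 : ℝ) = 2 * ((∑ l, (g⁻¹ * h) l X * p j l) * h Y i
        - h X i * ∑ l, (g⁻¹ * h) l Y * p j l) := by rw [e, e]; ring
    rw [this]
    simp only [Finset.mul_sum, Finset.sum_mul, ← Finset.sum_sub_distrib]
    exact Finset.sum_congr rfl fun l _ => by ring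
  ext i j
  simp only [actMat, Matrix.add_apply, Matrix.mul_apply, Matrix.transpose_apply, Matrix.zero_apply]
  have h1 : ∀ l, p l j = p j l := fun l => s.symm_right.apply j l
  simp only [h1, key]
  rw [Finset.sum_congr rfl fun l _ => mul_comm (p i l) _, key, add_zero]

/-- Separating the multiple of `g ∧ g` that carries the coefficient of `h ∧ p`. -/
theorem blockTensor_eq (s : IsSplitting g h p) (c₁ c₂ c₃ : ℝ) :
    blockTensor h p c₁ c₂ c₃
      = (c₂ / 2) • kn g g + (c₁ - c₂ / 2) • kn h h + (c₃ - c₂ / 2) • kn p p := by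
  rw [s.add_eq, kn_add_left, kn_add_right, kn_add_right, kn_comm p h, blockTensor]
  funext I
  simp only [Pi.add_apply, Pi.smul_apply, smul_eq_mul]
  ring

/-- The reason for all pseudosymmetries: up to `c₂ X ∧ Y`, the curvature endomorphisms of a block
tensor preserve both blocks and act skew-symmetrically on them, so they annihilate every tensor
that is built from `h` and `p`. -/
theorem dot_blockTensor (s : IsSplitting g h p) (c₁ c₂ c₃ : ℝ) (H : Tensor n k)
    (hH : ∀ T, actMat T h = 0 → actMat T p = 0 → act T H = 0) :
    dot g (blockTensor h p c₁ c₂ c₃) H = c₂ • tachibana g H := by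
  funext I X Y
  have h1 := hH _ (s.actMat_curvEndo_self X Y) (s.actMat_curvEndo_other X Y)
  have h2 := hH _ (s.swap.actMat_curvEndo_other X Y) (s.swap.actMat_curvEndo_self X Y)
  rw [dot_eq_act, Pi.smul_apply, Pi.smul_apply, Pi.smul_apply, tachibana_eq_act,
    s.blockTensor_eq]
  simp only [curvEndo_add, curvEndo_smul, act_add_left, act_smul_left, h1, h2,
    s.curvEndo_kn_metric, Pi.add_apply, Pi.smul_apply, smul_eq_mul, Pi.zero_apply]
  ring

theorem tachibana_blockTensor (s : IsSplitting g h p) (α β c₁ c₂ c₃ : ℝ) :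
    tachibana (α • h + β • p) (blockTensor h p c₁ c₂ c₃)
      = (α * c₂ - 2 * β * c₁) • tachibana h (kn h p)
        + (β * c₂ - 2 * α * c₃) • tachibana p (kn h p) := by
  rw [blockTensor]
  simp only [tachibana_add_left, tachibana_add_right, tachibana_smul_left, tachibana_smul_right,
    tachibana_kn_same s.symm_left, tachibana_kn_same s.symm_right,
    tachibana_kn_self s.symm_left s.symm_right, tachibana_kn_self s.symm_right s.symm_left,
    kn_comm p h]
  module

theorem tachibana_metric_blockTensor (s : IsSplitting g h p) (c₁ c₂ c₃ : ℝ) :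
    tachibana g (blockTensor h p c₁ c₂ c₃)
      = (c₂ - 2 * c₁) • tachibana h (kn h p) + (c₂ - 2 * c₃) • tachibana p (kn h p) := by
  have h1 := s.tachibana_blockTensor 1 1 c₁ c₂ c₃
  rwa [one_smul, one_smul, ← s.add_eq, one_mul, mul_one] at h1

theorem act_blockTensor {T : Matrix (Fin n) (Fin n) ℝ} (hh : actMat T h = 0) (hp : actMat T p = 0)
    (c₁ c₂ c₃ : ℝ) : act T (blockTensor h p c₁ c₂ c₃) = 0 := by
  simp [blockTensor, act_add_right, act_smul_right, act_kn, hh, hp, kn_zero_left, kn_zero_right]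

theorem act_matrix {T : Matrix (Fin n) (Fin n) ℝ} (hh : actMat T h = 0) (hp : actMat T p = 0)
    (α β : ℝ) : act T (tensorOfMatrix (α • h + β • p)) = 0 := by
  rw [act_tensorOfMatrix, actMat_add, actMat_smul, actMat_smul, hh, hp]
  funext I
  simp [tensorOfMatrix]

theorem act_halfKn_eq_zero (s : IsSplitting g h p) {T : Matrix (Fin n) (Fin n) ℝ}
    (hh : actMat T h = 0) (hp : actMat T p = 0) (α β : ℝ) :
    act T (halfKn g (α • h + β • p)) = 0 := by
  rw [act_halfKn, actMat_add, actMat_smul, actMat_smul, s.add_eq, actMat_add, hh, hp]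
  simp [halfKn_zero_left, halfKn_zero_right]

/-- A symmetric tensor whose endomorphism preserves the two blocks is compatible with every block
tensor. -/
theorem isCompatible_blockTensor (s : IsSplitting g h p) {E : Matrix (Fin n) (Fin n) ℝ}
    (hE : E.IsSymm) (hEh : (E * g⁻¹ * h).IsSymm) (c₁ c₂ c₃ : ℝ) :
    IsCompatible g (blockTensor h p c₁ c₂ c₃) E := by
  have hEg : (E * g⁻¹ * g).IsSymm := by
    rwa [mul_assoc, Matrix.nonsing_inv_mul _ s.isUnit_det, mul_one]
  have hEp : (E * g⁻¹ * p).IsSymm := by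
    have : E * g⁻¹ * p = E * g⁻¹ * g - E * g⁻¹ * h := by
      rw [s.add_eq, ← mul_sub, add_sub_cancel_left]
    rw [this]
    exact hEg.sub hEh
  rw [s.blockTensor_eq]
  have hi := s.inv_symm.eq
  exact (((isCompatible_kn_self (by rwa [hi])).smul _).add
    ((isCompatible_kn_self (by rwa [hi])).smul _)).add
    ((isCompatible_kn_self (by rwa [hi])).smul _)

end IsSplitting

end

section

/-! ### Partial derivatives in the coordinates -/

variable {n : ℕ}

theorem pd_congr {φ ψ : Scalar n} {x : Fin n → ℝ} (h : φ =ᶠ[nhds x] ψ) (i : Fin n) :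
    pd i φ x = pd i ψ x := by
  rw [pd, pd, h.fderiv_eq]

theorem pd_const (i : Fin n) (c : ℝ) (x : Fin n → ℝ) : pd i (fun _ => c) x = 0 := by
  simp [pd]

theorem pd_neg (i : Fin n) (φ : Scalar n) (x : Fin n → ℝ) :
    pd i (fun y => -φ y) x = -pd i φ x := by
  simp [pd]

theorem pd_add {φ ψ : Scalar n} {x : Fin n → ℝ} (hφ : DifferentiableAt ℝ φ x)
    (hψ : DifferentiableAt ℝ ψ x) (i : Fin n) :
    pd i (fun y => φ y + ψ y) x = pd i φ x + pd i ψ x := by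
  simp [pd, fderiv_fun_add hφ hψ]

theorem pd_sub {φ ψ : Scalar n} {x : Fin n → ℝ} (hφ : DifferentiableAt ℝ φ x)
    (hψ : DifferentiableAt ℝ ψ x) (i : Fin n) :
    pd i (fun y => φ y - ψ y) x = pd i φ x - pd i ψ x := by
  simp [pd, fderiv_fun_sub hφ hψ]

theorem pd_mul {φ ψ : Scalar n} {x : Fin n → ℝ} (hφ : DifferentiableAt ℝ φ x)
    (hψ : DifferentiableAt ℝ ψ x) (i : Fin n) :
    pd i (fun y => φ y * ψ y) x = pd i φ x * ψ x + φ x * pd i ψ x := by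
  simp [pd, fderiv_fun_mul hφ hψ]
  ring

theorem pd_sum {ι : Type*} (s : Finset ι) {φ : ι → Scalar n} {x : Fin n → ℝ}
    (hφ : ∀ a ∈ s, DifferentiableAt ℝ (φ a) x) (i : Fin n) :
    pd i (fun y => ∑ a ∈ s, φ a y) x = ∑ a ∈ s, pd i (φ a) x := by
  simp [pd, fderiv_fun_sum hφ]

/-- The derivative of a function of the two fibre coordinates in the direction `v`. -/
def dirDeriv (v : ℝ × ℝ) (ψ : ℝ × ℝ → ℝ) : ℝ × ℝ → ℝ := fun z => fderiv ℝ ψ z v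

theorem hasFDerivAt_radial_mul_fiber {G : ℝ → ℝ} {G' : ℝ} {ψ : ℝ × ℝ → ℝ} {x : Fin 4 → ℝ}
    (hG : HasDerivAt G G' (x 1)) (hψ : DifferentiableAt ℝ ψ (x 2, x 3)) :
    HasFDerivAt (fun y : Fin 4 → ℝ => G (y 1) * ψ (y 2, y 3))
      (G (x 1) • (fderiv ℝ ψ (x 2, x 3)).comp
        ((ContinuousLinearMap.proj (R := ℝ) (φ := fun _ : Fin 4 => ℝ) 2).prod
          (ContinuousLinearMap.proj (R := ℝ) (φ := fun _ : Fin 4 => ℝ) 3)) +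
        ψ (x 2, x 3) • (G' • ContinuousLinearMap.proj (R := ℝ) (φ := fun _ : Fin 4 => ℝ) 1)) x := by
  have h1 : HasFDerivAt (fun y : Fin 4 → ℝ => y 1)
    (ContinuousLinearMap.proj (R := ℝ) (φ := fun _ : Fin 4 => ℝ) 1) x := hasFDerivAt_apply 1 x
  have h2 : HasFDerivAt (fun y : Fin 4 → ℝ => y 2)
    (ContinuousLinearMap.proj (R := ℝ) (φ := fun _ : Fin 4 => ℝ) 2) x := hasFDerivAt_apply 2 x
  have h3 : HasFDerivAt (fun y : Fin 4 → ℝ => y 3)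
    (ContinuousLinearMap.proj (R := ℝ) (φ := fun _ : Fin 4 => ℝ) 3) x := hasFDerivAt_apply 3 x
  exact (hG.comp_hasFDerivAt x h1).mul (hψ.hasFDerivAt.comp x (h2.prodMk h3))

theorem differentiableAt_radial_mul_fiber {G : ℝ → ℝ} {G' : ℝ} {ψ : ℝ × ℝ → ℝ} {x : Fin 4 → ℝ}
    (hG : HasDerivAt G G' (x 1)) (hψ : DifferentiableAt ℝ ψ (x 2, x 3)) :
    DifferentiableAt ℝ (fun y : Fin 4 → ℝ => G (y 1) * ψ (y 2, y 3)) x :=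
  (hasFDerivAt_radial_mul_fiber hG hψ).differentiableAt

/-- The partial derivatives of a product of a function of `r` and a function of `(x³, x⁴)`; all
coefficients of the metric and of its connection are of this form. -/
theorem pd_radial_mul_fiber {G : ℝ → ℝ} {G' : ℝ} {ψ : ℝ × ℝ → ℝ} {x : Fin 4 → ℝ}
    (hG : HasDerivAt G G' (x 1)) (hψ : DifferentiableAt ℝ ψ (x 2, x 3)) (i : Fin 4) :
    pd i (fun y => G (y 1) * ψ (y 2, y 3)) x
      = ![0, G' * ψ (x 2, x 3), G (x 1) * dirDeriv (1, 0) ψ (x 2, x 3),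
          G (x 1) * dirDeriv (0, 1) ψ (x 2, x 3)] i := by
  rw [pd, (hasFDerivAt_radial_mul_fiber hG hψ).fderiv]
  fin_cases i <;> simp [dirDeriv, mul_comm, Prod.mk_zero_zero]

theorem pd_fiber {ψ : ℝ × ℝ → ℝ} {x : Fin 4 → ℝ} (hψ : DifferentiableAt ℝ ψ (x 2, x 3))
    (i : Fin 4) :
    pd i (fun y => ψ (y 2, y 3)) x
      = ![0, 0, dirDeriv (1, 0) ψ (x 2, x 3), dirDeriv (0, 1) ψ (x 2, x 3)] i := by
  have h := pd_radial_mul_fiber (hasDerivAt_const (x 1) (1 : ℝ)) hψ i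
  simpa using h

theorem contDiffOn_dirDeriv {V : Set (ℝ × ℝ)} (hV : IsOpen V) {ψ : ℝ × ℝ → ℝ}
    (hψ : ContDiffOn ℝ ∞ ψ V) (v : ℝ × ℝ) : ContDiffOn ℝ ∞ (dirDeriv v ψ) V :=
  (hψ.fderiv_of_isOpen hV (by simp)).clm_apply contDiffOn_const

theorem differentiableAt_of_contDiffOn {V : Set (ℝ × ℝ)} (hV : IsOpen V) {ψ : ℝ × ℝ → ℝ}
    (hψ : ContDiffOn ℝ ∞ ψ V) {z : ℝ × ℝ} (hz : z ∈ V) : DifferentiableAt ℝ ψ z :=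
  (hψ.contDiffAt (hV.mem_nhds hz)).differentiableAt (by simp)

theorem dirDeriv_comm {V : Set (ℝ × ℝ)} (hV : IsOpen V) {ψ : ℝ × ℝ → ℝ}
    (hψ : ContDiffOn ℝ ∞ ψ V) {z : ℝ × ℝ} (hz : z ∈ V) (v w : ℝ × ℝ) :
    dirDeriv v (dirDeriv w ψ) z = dirDeriv w (dirDeriv v ψ) z := by
  have hc := hψ.contDiffAt (hV.mem_nhds hz)
  have hd : DifferentiableAt ℝ (fderiv ℝ ψ) z :=
    ((hψ.fderiv_of_isOpen hV (m := ∞) (by simp)).contDiffAt (hV.mem_nhds hz)).differentiableAt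
      (by simp)
  have key : ∀ v w, dirDeriv v (dirDeriv w ψ) z = fderiv ℝ (fderiv ℝ ψ) z v w := by
    intro v w
    have : HasFDerivAt (fun y => fderiv ℝ ψ y w) ((fderiv ℝ (fderiv ℝ ψ) z).flip w) z := by
      simpa using hd.hasFDerivAt.clm_apply (hasFDerivAt_const w z)
    change fderiv ℝ (fun y => fderiv ℝ ψ y w) z v = _
    rw [this.fderiv]
    rfl
  rw [key, key]
  exact (hc.isSymmSndFDerivAt (by
    rw [minSmoothness_of_isRCLikeNormedField]
    exact WithTop.coe_le_coe.2 (le_top : (2 : ℕ∞) ≤ ⊤))).eq v w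

theorem differentiableAt_div {u f : ℝ × ℝ → ℝ} {z : ℝ × ℝ} (hu : DifferentiableAt ℝ u z)
    (hf : DifferentiableAt ℝ f z) (h0 : f z ≠ 0) : DifferentiableAt ℝ (fun y => u y / f y) z := by
  have h : HasFDerivAt (fun y => u y * (f y)⁻¹) _ z :=
    hu.hasFDerivAt.mul ((hasDerivAt_inv h0).comp_hasFDerivAt z hf.hasFDerivAt)
  simpa only [div_eq_mul_inv] using h.differentiableAt

theorem dirDeriv_div {u f : ℝ × ℝ → ℝ} {z : ℝ × ℝ} (hu : DifferentiableAt ℝ u z)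
    (hf : DifferentiableAt ℝ f z) (h0 : f z ≠ 0) (v : ℝ × ℝ) :
    dirDeriv v (fun y => u y / f y) z
      = dirDeriv v u z / f z - u z * dirDeriv v f z / f z ^ 2 := by
  have h : HasFDerivAt (fun y => u y * (f y)⁻¹) _ z :=
    hu.hasFDerivAt.mul ((hasDerivAt_inv h0).comp_hasFDerivAt z hf.hasFDerivAt)
  simp only [div_eq_mul_inv (u _)]
  rw [dirDeriv, h.fderiv]
  simp [dirDeriv]
  field_simp
  ring

theorem dirDeriv_inv_sq {f : ℝ × ℝ → ℝ} {z : ℝ × ℝ} (hf : DifferentiableAt ℝ f z)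
    (h0 : f z ≠ 0) (v : ℝ × ℝ) :
    dirDeriv v (fun y => 1 / f y ^ 2) z = -2 * dirDeriv v f z / f z ^ 3 := by
  have h2 : DifferentiableAt ℝ (fun y => f y ^ 2) z := hf.pow 2
  have h3 := dirDeriv_div (differentiableAt_const (1 : ℝ)) h2 (pow_ne_zero 2 h0) v
  have h4 : dirDeriv v (fun y => f y ^ 2) z = 2 * f z * dirDeriv v f z := by
    simp [dirDeriv, fderiv_fun_pow 2 hf]
  have h5 : dirDeriv v (fun _ : ℝ × ℝ => (1 : ℝ)) z = 0 := by simp [dirDeriv]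
  rw [h3, h4, h5]
  field_simp
  ring

/-- The function `F` of the fibre coordinates. -/
def fiberCurv (f : ℝ × ℝ → ℝ) : ℝ × ℝ → ℝ := fun z =>
  dirDeriv (1, 0) f z ^ 2 + dirDeriv (0, 1) f z ^ 2
    - f z * (dirDeriv (1, 0) (dirDeriv (1, 0) f) z + dirDeriv (0, 1) (dirDeriv (0, 1) f) z)

theorem contDiffOn_fiberCurv {V : Set (ℝ × ℝ)} (hV : IsOpen V) {f : ℝ × ℝ → ℝ}
    (hf : ContDiffOn ℝ ∞ f V) : ContDiffOn ℝ ∞ (fiberCurv f) V := by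
  have h1 := fun v => contDiffOn_dirDeriv hV hf v
  have h2 := fun v => contDiffOn_dirDeriv hV (h1 v) v
  exact (((h1 _).pow 2).add ((h1 _).pow 2)).sub (hf.mul ((h2 _).add (h2 _)))

/-- The points of `ℝ⁴` with `r ≠ 0` and `(x³, x⁴) ∈ V`. -/
def domain (V : Set (ℝ × ℝ)) : Set (Fin 4 → ℝ) := {x | x 1 ≠ 0 ∧ (x 2, x 3) ∈ V}

theorem isOpen_domain {V : Set (ℝ × ℝ)} (hV : IsOpen V) : IsOpen (domain V) :=
  (isOpen_ne.preimage (continuous_apply 1)).inter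
    (hV.preimage (by fun_prop : Continuous fun x : Fin 4 → ℝ => (x 2, x 3)))

theorem fiberF_eq {V : Set (ℝ × ℝ)} (hV : IsOpen V) {f : ℝ × ℝ → ℝ}
    (hf : ContDiffOn ℝ ∞ f V) {x : Fin 4 → ℝ} (hx : x ∈ domain V) :
    fiberF f x = fiberCurv f (x 2, x 3) := by
  have hd : ∀ y ∈ domain V, DifferentiableAt ℝ f (y 2, y 3) := fun y hy =>
    differentiableAt_of_contDiffOn hV hf hy.2
  have hd2 : ∀ v, DifferentiableAt ℝ (dirDeriv v f) (x 2, x 3) := fun v =>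
    differentiableAt_of_contDiffOn hV (contDiffOn_dirDeriv hV hf v) hx.2
  have hnear := (isOpen_domain hV).mem_nhds hx
  have e2 : pd 2 (fun y : Fin 4 → ℝ => f (y 2, y 3))
      =ᶠ[nhds x] fun y => dirDeriv (1, 0) f (y 2, y 3) := by
    filter_upwards [hnear] with y hy
    rw [pd_fiber (hd y hy)]; rfl
  have e3 : pd 3 (fun y : Fin 4 → ℝ => f (y 2, y 3))
      =ᶠ[nhds x] fun y => dirDeriv (0, 1) f (y 2, y 3) := by
    filter_upwards [hnear] with y hy
    rw [pd_fiber (hd y hy)]; rfl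
  simp only [fiberF, fiberCurv]
  rw [pd_congr e2, pd_congr e3, e2.eq_of_nhds, e3.eq_of_nhds, pd_fiber (hd2 _), pd_fiber (hd2 _)]
  rfl

theorem pd_fiberF {V : Set (ℝ × ℝ)} (hV : IsOpen V) {f : ℝ × ℝ → ℝ}
    (hf : ContDiffOn ℝ ∞ f V) {x : Fin 4 → ℝ} (hx : x ∈ domain V) (i : Fin 4) :
    pd i (fiberF f) x = ![0, 0, dirDeriv (1, 0) (fiberCurv f) (x 2, x 3),
      dirDeriv (0, 1) (fiberCurv f) (x 2, x 3)] i := by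
  have e : fiberF f =ᶠ[nhds x] fun y => fiberCurv f (y 2, y 3) := by
    filter_upwards [(isOpen_domain hV).mem_nhds hx] with y hy
    exact fiberF_eq hV hf hy
  rw [pd_congr e, pd_fiber (differentiableAt_of_contDiffOn hV (contDiffOn_fiberCurv hV hf) hx.2)]

end

section

/-! ### The Levi-Civita connection of the metric -/

/-- The block of the metric tangent to the `(t, r)`-planes, with `A = g₀₀`. -/
def radialBlock (A : ℝ) : Matrix (Fin 4) (Fin 4) ℝ := !![A, 1, 0, 0; 1, 0, 0, 0; 0, 0, 0, 0; 0, 0, 0, 0]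

/-- The block of the metric tangent to the `(x³, x⁴)`-planes, with `B = -g₂₂ = -g₃₃`. -/
def fiberBlock (B : ℝ) : Matrix (Fin 4) (Fin 4) ℝ :=
  !![0, 0, 0, 0; 0, 0, 0, 0; 0, 0, -B, 0; 0, 0, 0, -B]

/-- The coefficient `g₀₀ = -2(a - 2br - q/r)`. -/
def lapse (a b q r : ℝ) : ℝ := -2 * (a - 2 * b * r - q * r⁻¹)

/-- The inverse of `radialBlock A + fiberBlock B`. -/
def invBlock (A B : ℝ) : Matrix (Fin 4) (Fin 4) ℝ :=
  !![0, 1, 0, 0; 1, -A, 0, 0; 0, 0, -B⁻¹, 0; 0, 0, 0, -B⁻¹]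

theorem block_mul_invBlock {A B : ℝ} (hB : B ≠ 0) :
    (radialBlock A + fiberBlock B) * invBlock A B = 1 := by
  ext i j
  fin_cases i <;> fin_cases j <;>
    simp [radialBlock, fiberBlock, invBlock, Matrix.mul_apply, Fin.sum_univ_four, hB]

theorem block_inv {A B : ℝ} (hB : B ≠ 0) :
    (radialBlock A + fiberBlock B)⁻¹ = invBlock A B :=
  Matrix.inv_eq_right_inv (block_mul_invBlock hB)

theorem isSplitting_block {A B : ℝ} (hB : B ≠ 0) :
    IsSplitting (radialBlock A + fiberBlock B) (radialBlock A) (fiberBlock B) where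
  symm_left := by ext i j; fin_cases i <;> fin_cases j <;> simp [radialBlock]
  symm_right := by ext i j; fin_cases i <;> fin_cases j <;> simp [fiberBlock]
  add_eq := rfl
  isUnit_det := Matrix.isUnit_det_of_right_inverse (block_mul_invBlock hB)
  left_left := by
    rw [block_inv hB]
    ext i j
    fin_cases i <;> fin_cases j <;>
      simp [radialBlock, invBlock, Matrix.mul_apply, Fin.sum_univ_four]
  left_right := by
    rw [block_inv hB]
    ext i j
    fin_cases i <;> fin_cases j <;>
      simp [radialBlock, fiberBlock, invBlock, Matrix.mul_apply, Fin.sum_univ_four]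

theorem metric_eq (a b q : ℝ) (f : ℝ × ℝ → ℝ) (x : Fin 4 → ℝ) :
    metric a b q f x
      = radialBlock (lapse a b q (x 1)) + fiberBlock ((x 1) ^ 2 * (1 / f (x 2, x 3) ^ 2)) := by
  ext i j
  fin_cases i <;> fin_cases j <;> simp [metric, radialBlock, fiberBlock, lapse, div_eq_mul_inv]

/-- The array of Christoffel symbols `Γᵐᵢⱼ` in terms of its seven different entries
`A'/2, A A'/2, r/φ², A r/φ², 1/r, φ₃/φ, φ₄/φ`. -/
def christoffelArray (e : Fin 7 → ℝ) : Fin 4 → Matrix (Fin 4) (Fin 4) ℝ :=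
  ![!![-e 0, 0, 0, 0; 0, 0, 0, 0; 0, 0, e 2, 0; 0, 0, 0, e 2],
    !![e 1, e 0, 0, 0; e 0, 0, 0, 0; 0, 0, -e 3, 0; 0, 0, 0, -e 3],
    !![0, 0, 0, 0; 0, 0, e 4, 0; 0, e 4, -e 5, -e 6; 0, 0, -e 6, e 5],
    !![0, 0, 0, 0; 0, 0, 0, e 4; 0, 0, e 6, -e 5; 0, e 4, -e 5, -e 6]]

/-- The radial factors of the seven entries of `christoffelArray`. -/
def radialFactor (a b q : ℝ) : Fin 7 → ℝ → ℝ :=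
  ![fun r => 2 * b - q * (r ^ 2)⁻¹, fun r => lapse a b q r * (2 * b - q * (r ^ 2)⁻¹), fun r => r,
    fun r => lapse a b q r * r, fun r => r⁻¹, fun _ => 1, fun _ => 1]

/-- The derivatives of the radial factors. -/
def radialFactorDeriv (a b q r : ℝ) : Fin 7 → ℝ :=
  ![2 * q / r ^ 3, (4 * b - 2 * q / r ^ 2) * (2 * b - q / r ^ 2) + lapse a b q r * (2 * q / r ^ 3),
    1, (4 * b - 2 * q / r ^ 2) * r + lapse a b q r, -1 / r ^ 2, 0, 0]

/-- The factors of the entries of `christoffelArray` depending on the fibre coordinates. -/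
def fiberFactor (f : ℝ × ℝ → ℝ) : Fin 7 → ℝ × ℝ → ℝ :=
  ![fun _ => 1, fun _ => 1, fun z => 1 / f z ^ 2, fun z => 1 / f z ^ 2, fun _ => 1,
    fun z => dirDeriv (1, 0) f z / f z, fun z => dirDeriv (0, 1) f z / f z]

theorem hasDerivAt_lapse (a b q : ℝ) {r : ℝ} (hr : r ≠ 0) :
    HasDerivAt (lapse a b q) (4 * b - 2 * q / r ^ 2) r := by
  have h := (((hasDerivAt_const r a).sub ((hasDerivAt_id r).const_mul (2 * b))).sub
    ((hasDerivAt_inv hr).const_mul q)).const_mul (-2)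
  refine h.congr_deriv ?_
  field_simp
  ring

theorem hasDerivAt_radialFactor (a b q : ℝ) {r : ℝ} (hr : r ≠ 0) (s : Fin 7) :
    HasDerivAt (radialFactor a b q s) (radialFactorDeriv a b q r s) r := by
  have h0 : HasDerivAt (fun r : ℝ => 2 * b - q * (r ^ 2)⁻¹) (2 * q / r ^ 3) r := by
    have h := (hasDerivAt_const r (2 * b)).sub
      ((((hasDerivAt_id r).pow 2).inv (pow_ne_zero 2 hr)).const_mul q)
    refine h.congr_deriv ?_
    simp
    field_simp
  have hl := hasDerivAt_lapse a b q hr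
  fin_cases s
  · exact h0
  · have h := hl.mul h0
    exact h.congr_deriv (by simp [radialFactorDeriv, div_eq_mul_inv])
  · exact hasDerivAt_id r
  · have h := hl.mul (hasDerivAt_id r)
    exact h.congr_deriv (by simp [radialFactorDeriv])
  · have h := hasDerivAt_inv hr
    exact h.congr_deriv (by simp [radialFactorDeriv, neg_div])
  · exact hasDerivAt_const r 1
  · exact hasDerivAt_const r 1

theorem pd_christoffelArray (i m j k : Fin 4) (e : Fin 7 → Scalar 4) (x : Fin 4 → ℝ) :
    pd i (fun y => christoffelArray (fun s => e s y) m j k) x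
      = christoffelArray (fun s => pd i (e s) x) m j k := by
  fin_cases m <;> fin_cases j <;> fin_cases k <;>
    simp [christoffelArray, pd_const, pd_neg]

variable {a b q : ℝ} {f : ℝ × ℝ → ℝ} {V : Set (ℝ × ℝ)}

theorem differentiableAt_fiberFactor (hV : IsOpen V) (hf : ContDiffOn ℝ ∞ f V)
    (hf0 : ∀ z ∈ V, f z ≠ 0) {z : ℝ × ℝ} (hz : z ∈ V) (s : Fin 7) :
    DifferentiableAt ℝ (fiberFactor f s) z := by
  have h1 := differentiableAt_of_contDiffOn hV hf hz
  have h2 := fun v => differentiableAt_of_contDiffOn hV (contDiffOn_dirDeriv hV hf v) hz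
  have h3 : DifferentiableAt ℝ (fun z => 1 / f z ^ 2) z :=
    differentiableAt_div (differentiableAt_const (1 : ℝ)) (h1.fun_pow 2) (pow_ne_zero 2 (hf0 z hz))
  fin_cases s
  · exact differentiableAt_const _
  · exact differentiableAt_const _
  · exact h3
  · exact h3
  · exact differentiableAt_const _
  · exact differentiableAt_div (h2 _) h1 (hf0 z hz)
  · exact differentiableAt_div (h2 _) h1 (hf0 z hz)

/-- The partial derivatives of the nonconstant components of the metric: `∂ᵢA` and `∂ᵢB`. -/
theorem pd_metric (hV : IsOpen V) (hf : ContDiffOn ℝ ∞ f V) (hf0 : ∀ z ∈ V, f z ≠ 0)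
    {x : Fin 4 → ℝ} (hx : x ∈ domain V) (i : Fin 4) :
    pd i (fun y => lapse a b q (y 1)) x = ![0, 4 * b - 2 * q / x 1 ^ 2, 0, 0] i ∧
    pd i (fun y => (y 1) ^ 2 * (1 / f (y 2, y 3) ^ 2)) x
      = ![0, 2 * x 1 * (1 / f (x 2, x 3) ^ 2),
          x 1 ^ 2 * (-2 * dirDeriv (1, 0) f (x 2, x 3) / f (x 2, x 3) ^ 3),
          x 1 ^ 2 * (-2 * dirDeriv (0, 1) f (x 2, x 3) / f (x 2, x 3) ^ 3)] i := by
  constructor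
  · have h := pd_radial_mul_fiber (hasDerivAt_lapse a b q hx.1)
      (differentiableAt_const (1 : ℝ) : DifferentiableAt ℝ (fun _ => (1 : ℝ)) (x 2, x 3)) i
    simpa [dirDeriv] using h
  · have h1 := differentiableAt_of_contDiffOn hV hf hx.2
    have h2 : HasDerivAt (fun r : ℝ => r ^ 2) (2 * x 1) (x 1) := by
      simpa using (hasDerivAt_pow 2 (x 1))
    have h := pd_radial_mul_fiber h2 (differentiableAt_fiberFactor hV hf hf0 hx.2 2) i
    rw [← dirDeriv_inv_sq h1 (hf0 _ hx.2), ← dirDeriv_inv_sq h1 (hf0 _ hx.2)]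
    exact h

/-- Differentiating the blocks: only the entries `A` and `B` contribute. -/
theorem pd_blocks (α β : Scalar 4) (x : Fin 4 → ℝ) (i j k : Fin 4) :
    pd i (fun y => radialBlock (α y) j k) x = !![pd i α x, 0, 0, 0; 0, 0, 0, 0; 0, 0, 0, 0;
      0, 0, 0, 0] j k ∧
    pd i (fun y => fiberBlock (β y) j k) x = fiberBlock (pd i β x) j k ∧
    pd i (fun y => (radialBlock (α y) + fiberBlock (β y)) j k) x =
      !![pd i α x, 0, 0, 0; 0, 0, 0, 0; 0, 0, -pd i β x, 0; 0, 0, 0, -pd i β x] j k := by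
  refine ⟨?_, ?_, ?_⟩ <;> fin_cases j <;> fin_cases k <;>
    simp [radialBlock, fiberBlock, pd_const, pd_neg]

theorem christoffelEntries_eq (a b q r : ℝ) (f : ℝ × ℝ → ℝ) (z : ℝ × ℝ) :
    (fun s => radialFactor a b q s r * fiberFactor f s z)
      = ![2 * b - q * (r ^ 2)⁻¹, lapse a b q r * (2 * b - q * (r ^ 2)⁻¹), r * (1 / f z ^ 2),
          lapse a b q r * r * (1 / f z ^ 2), r⁻¹, dirDeriv (1, 0) f z / f z,
          dirDeriv (0, 1) f z / f z] := by
  funext s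
  fin_cases s <;> simp [radialFactor, fiberFactor]

theorem christoffel_eq (hV : IsOpen V) (hf : ContDiffOn ℝ ∞ f V) (hf0 : ∀ z ∈ V, f z ≠ 0)
    {x : Fin 4 → ℝ} (hx : x ∈ domain V) (m i j : Fin 4) :
    christoffel (metric a b q f) m i j x
      = christoffelArray (fun s => radialFactor a b q s (x 1) * fiberFactor f s (x 2, x 3)) m i j
      := by
  have hr := hx.1
  have hφ := hf0 _ hx.2
  have hB : (x 1) ^ 2 * (1 / f (x 2, x 3) ^ 2) ≠ 0 := by positivity
  have hd := pd_metric (a := a) (b := b) (q := q) hV hf hf0 hx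
  simp only [christoffel, metric_eq, block_inv hB, (pd_blocks _ _ x _ _ _).2.2,
    fun i => (hd i).1, fun i => (hd i).2, Fin.sum_univ_four]
  rw [christoffelEntries_eq]
  generalize lapse a b q (x 1) = A
  generalize dirDeriv (1, 0) f (x 2, x 3) = u
  generalize dirDeriv (0, 1) f (x 2, x 3) = v
  generalize f (x 2, x 3) = φ at *
  generalize x 1 = r at *
  clear hd hx hf hf0
  fin_cases m <;> fin_cases i <;> fin_cases j <;>
    simp [christoffelArray, invBlock] <;> field_simp <;> ring

end

section

/-! ### The curvature of the metric -/

/-- The coefficient of `h ∧ h` in the curvature tensor. -/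
def coeffRadial (q r : ℝ) : ℝ := -q / r ^ 3

/-- The coefficient of `h ∧ p` in the curvature tensor. -/
def coeffMixed (b q r : ℝ) : ℝ := (q - 2 * b * r ^ 2) / r ^ 3

/-- The coefficient of `p ∧ p` in the curvature tensor. -/
def coeffFiber (a b q r F : ℝ) : ℝ := (2 * a * r - 4 * b * r ^ 2 - F * r - 2 * q) / (2 * r ^ 3)

/-- The partial derivatives `∂ᵢ` of the seven entries of `christoffelArray`, as functions of `r`,
of `φ` and of its derivatives `u = φ₃`, `v = φ₄`, `uu = φ₃₃`, `uv = φ₃₄`, `vv = φ₄₄`. -/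
def christoffelEntriesDeriv (a b q r φ u v uu uv vv : ℝ) : Fin 4 → Fin 7 → ℝ :=
  ![![0, 0, 0, 0, 0, 0, 0],
    ![2 * q / r ^ 3, (4 * b - 2 * q / r ^ 2) * (2 * b - q / r ^ 2) + lapse a b q r * (2 * q / r ^ 3),
      1 / φ ^ 2, ((4 * b - 2 * q / r ^ 2) * r + lapse a b q r) * (1 / φ ^ 2), -1 / r ^ 2, 0, 0],
    ![0, 0, r * (-2 * u / φ ^ 3), lapse a b q r * r * (-2 * u / φ ^ 3), 0,
      uu / φ - u * u / φ ^ 2, uv / φ - v * u / φ ^ 2],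
    ![0, 0, r * (-2 * v / φ ^ 3), lapse a b q r * r * (-2 * v / φ ^ 3), 0,
      uv / φ - u * v / φ ^ 2, vv / φ - v * v / φ ^ 2]]

variable {a b q : ℝ} {f : ℝ × ℝ → ℝ} {V : Set (ℝ × ℝ)}

theorem pd_christoffel (hV : IsOpen V) (hf : ContDiffOn ℝ ∞ f V) (hf0 : ∀ z ∈ V, f z ≠ 0)
    {x : Fin 4 → ℝ} (hx : x ∈ domain V) (i m j k : Fin 4) :
    pd i (christoffel (metric a b q f) m j k) x
      = christoffelArray (christoffelEntriesDeriv a b q (x 1) (f (x 2, x 3))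
          (dirDeriv (1, 0) f (x 2, x 3)) (dirDeriv (0, 1) f (x 2, x 3))
          (dirDeriv (1, 0) (dirDeriv (1, 0) f) (x 2, x 3))
          (dirDeriv (1, 0) (dirDeriv (0, 1) f) (x 2, x 3))
          (dirDeriv (0, 1) (dirDeriv (0, 1) f) (x 2, x 3)) i) m j k := by
  have e : christoffel (metric a b q f) m j k =ᶠ[nhds x] fun y => christoffelArray
      (fun s => radialFactor a b q s (y 1) * fiberFactor f s (y 2, y 3)) m j k := by
    filter_upwards [(isOpen_domain hV).mem_nhds hx] with y hy
    exact christoffel_eq hV hf hf0 hy m j k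
  rw [pd_congr e, pd_christoffelArray i m j k
    (fun s y => radialFactor a b q s (y 1) * fiberFactor f s (y 2, y 3))]
  congr 1
  have h1 := differentiableAt_of_contDiffOn hV hf hx.2
  have h2 := fun v => differentiableAt_of_contDiffOn hV (contDiffOn_dirDeriv hV hf v) hx.2
  have h0 := hf0 _ hx.2
  have hc := dirDeriv_comm hV hf hx.2 (0, 1) (1, 0)
  -- Mixed second derivatives of `f` occur in both orders; `hc` normalises them.
  have hone : ∀ v z, dirDeriv v (fun _ : ℝ × ℝ => (1 : ℝ)) z = 0 := by simp [dirDeriv]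
  funext s
  rw [pd_radial_mul_fiber (hasDerivAt_radialFactor a b q hx.1 s)
    (differentiableAt_fiberFactor hV hf hf0 hx.2 s)]
  fin_cases s <;>
    simp only [radialFactor, fiberFactor, radialFactorDeriv, Matrix.cons_val, Fin.zero_eta,
      Fin.mk_one, Fin.reduceFinMk, dirDeriv_inv_sq h1 h0, dirDeriv_div (h2 _) h1 h0, hone, hc] <;>
    fin_cases i <;> simp [christoffelEntriesDeriv]

/-- The mixed components `c₁ (h ∧ h) + c₂ (h ∧ p) + c₃ (p ∧ p)` with the last index raised. -/
def mixedBlock (A B c₁ c₂ c₃ : ℝ) (i j k m : Fin 4) : ℝ :=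
  let h := radialBlock A
  let p := fiberBlock B
  let δh : Matrix (Fin 4) (Fin 4) ℝ := Matrix.diagonal ![1, 1, 0, 0]
  let δp : Matrix (Fin 4) (Fin 4) ℝ := Matrix.diagonal ![0, 0, 1, 1]
  c₁ * (2 * (δh m i * h j k - δh m j * h i k))
    + c₂ * (δh m i * p j k + h j k * δp m i - h i k * δp m j - δh m j * p i k)
    + c₃ * (2 * (δp m i * p j k - δp m j * p i k))

theorem mixedBlock_swap (A B c₁ c₂ c₃ : ℝ) (i j k m : Fin 4) :
    mixedBlock A B c₁ c₂ c₃ j i k m = -mixedBlock A B c₁ c₂ c₃ i j k m := by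
  simp only [mixedBlock]
  ring

/-- Lowering the last index of `mixedBlock` gives back the block tensor. -/
theorem sum_mixedBlock (A B c₁ c₂ c₃ : ℝ) (I : Fin 4 → Fin 4) :
    ∑ m, (radialBlock A + fiberBlock B) m (I 3) * mixedBlock A B c₁ c₂ c₃ (I 0) (I 1) (I 2) m
      = blockTensor (radialBlock A) (fiberBlock B) c₁ c₂ c₃ I := by
  have key : ∀ i l,
      (∑ m, (radialBlock A + fiberBlock B) m l * Matrix.diagonal ![(1 : ℝ), 1, 0, 0] m i
        = radialBlock A i l) ∧
      (∑ m, (radialBlock A + fiberBlock B) m l * Matrix.diagonal ![(0 : ℝ), 0, 1, 1] m i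
        = fiberBlock B i l) := by
    intro i l
    constructor <;> fin_cases i <;> fin_cases l <;>
      simp [radialBlock, fiberBlock, Matrix.diagonal]
  have hs := fun i l => (key i l).1
  have hp := fun i l => (key i l).2
  generalize radialBlock A + fiberBlock B = G at *
  simp only [mixedBlock, blockTensor, kn, Pi.add_apply, Pi.smul_apply, smul_eq_mul, ← hs (I 0) (I 3),
    ← hs (I 1) (I 3), ← hp (I 0) (I 3), ← hp (I 1) (I 3), Finset.mul_sum, Finset.sum_mul,
    ← Finset.sum_add_distrib, ← Finset.sum_sub_distrib]
  exact Finset.sum_congr rfl fun m _ => by ring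

theorem curvatureUp_swap {n : ℕ} (g : MatrixField n) (i j k m : Fin n) (x : Fin n → ℝ) :
    curvatureUp g j i k m x = -curvatureUp g i j k m x := by
  simp only [curvatureUp, Finset.sum_sub_distrib]
  ring

set_option maxHeartbeats 4000000 in
theorem curvatureUp_eq (hV : IsOpen V) (hf : ContDiffOn ℝ ∞ f V) (hf0 : ∀ z ∈ V, f z ≠ 0)
    {x : Fin 4 → ℝ} (hx : x ∈ domain V) (i j k m : Fin 4) :
    curvatureUp (metric a b q f) i j k m x
      = mixedBlock (lapse a b q (x 1)) ((x 1) ^ 2 * (1 / f (x 2, x 3) ^ 2)) (coeffRadial q (x 1))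
          (coeffMixed b q (x 1)) (coeffFiber a b q (x 1) (fiberCurv f (x 2, x 3))) i j k m := by
  have hlt : ∀ i j : Fin 4, i < j → ∀ k m, curvatureUp (metric a b q f) i j k m x
      = mixedBlock (lapse a b q (x 1)) ((x 1) ^ 2 * (1 / f (x 2, x 3) ^ 2)) (coeffRadial q (x 1))
          (coeffMixed b q (x 1)) (coeffFiber a b q (x 1) (fiberCurv f (x 2, x 3))) i j k m := by
    -- Both sides are skew in `i`, `j`, so only the six pairs `i < j` have to be compared.
    have hr := hx.1
    have hφ := hf0 _ hx.2
    intro i j hij k m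
    simp only [curvatureUp, pd_christoffel hV hf hf0 hx, christoffel_eq hV hf hf0 hx,
      christoffelEntries_eq, fiberCurv, Fin.sum_univ_four]
    generalize dirDeriv (1, 0) f (x 2, x 3) = u
    generalize dirDeriv (0, 1) f (x 2, x 3) = v
    generalize dirDeriv (1, 0) (dirDeriv (1, 0) f) (x 2, x 3) = uu
    generalize dirDeriv (1, 0) (dirDeriv (0, 1) f) (x 2, x 3) = uv
    generalize dirDeriv (0, 1) (dirDeriv (0, 1) f) (x 2, x 3) = vv
    generalize f (x 2, x 3) = φ at *
    generalize x 1 = r at *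
    clear hx hf hf0
    fin_cases i <;> fin_cases j <;> first | exact absurd hij (by decide) | skip
    all_goals
      fin_cases k <;> fin_cases m <;>
        simp [christoffelArray, christoffelEntriesDeriv, mixedBlock, radialBlock, fiberBlock,
          Matrix.diagonal, coeffRadial, coeffMixed, coeffFiber, lapse] <;>
        field_simp <;> ring
  rcases lt_trichotomy i j with h | h | h
  · exact hlt i j h k m
  · subst h
    have h1 := curvatureUp_swap (metric a b q f) i i k m x
    have h2 := mixedBlock_swap (lapse a b q (x 1)) ((x 1) ^ 2 * (1 / f (x 2, x 3) ^ 2))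
      (coeffRadial q (x 1)) (coeffMixed b q (x 1))
      (coeffFiber a b q (x 1) (fiberCurv f (x 2, x 3))) i i k m
    linarith
  · rw [curvatureUp_swap, hlt j i h, mixedBlock_swap, neg_neg]

theorem riemann_eq (hV : IsOpen V) (hf : ContDiffOn ℝ ∞ f V) (hf0 : ∀ z ∈ V, f z ≠ 0)
    {x : Fin 4 → ℝ} (hx : x ∈ domain V) :
    riemann (metric a b q f) x
      = blockTensor (radialBlock (lapse a b q (x 1)))
          (fiberBlock ((x 1) ^ 2 * (1 / f (x 2, x 3) ^ 2))) (coeffRadial q (x 1))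
          (coeffMixed b q (x 1)) (coeffFiber a b q (x 1) (fiberCurv f (x 2, x 3))) := by
  funext I
  simp only [riemann, curvatureUp_eq hV hf hf0 hx, metric_eq, sum_mixedBlock]

end

section

/-! ### The curvature tensors as block tensors -/

theorem blockTensor_add {n : ℕ} (h p : Matrix (Fin n) (Fin n) ℝ) (c₁ c₂ c₃ d₁ d₂ d₃ : ℝ) :
    blockTensor h p c₁ c₂ c₃ + blockTensor h p d₁ d₂ d₃
      = blockTensor h p (c₁ + d₁) (c₂ + d₂) (c₃ + d₃) := by
  simp only [blockTensor]; module

theorem smul_blockTensor {n : ℕ} (h p : Matrix (Fin n) (Fin n) ℝ) (c c₁ c₂ c₃ : ℝ) :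
    c • blockTensor h p c₁ c₂ c₃ = blockTensor h p (c * c₁) (c * c₂) (c * c₃) := by
  simp only [blockTensor]; module

theorem kn_block {n : ℕ} (h p : Matrix (Fin n) (Fin n) ℝ) (α β γ δ : ℝ) :
    kn (α • h + β • p) (γ • h + δ • p)
      = blockTensor h p (α * γ) (α * δ + β * γ) (β * δ) := by
  simp only [blockTensor, kn_add_left, kn_add_right, kn_smul_left, kn_smul_right, kn_comm p h]
  module

theorem kn_metric_block {n : ℕ} (h p : Matrix (Fin n) (Fin n) ℝ) (γ δ : ℝ) :
    kn (h + p) (γ • h + δ • p) = blockTensor h p γ (δ + γ) δ := by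
  have := kn_block h p 1 1 γ δ
  simpa only [one_smul, one_mul] using this

theorem kn_metric_metric {n : ℕ} (h p : Matrix (Fin n) (Fin n) ℝ) :
    kn (h + p) (h + p) = blockTensor h p 1 2 1 := by
  have := kn_metric_block h p 1 1
  rw [one_smul, one_smul] at this
  rw [this]
  norm_num

/-- The first contraction of a block tensor, the blocks being two-dimensional. -/
theorem contract_blockTensor {A B : ℝ} (hB : B ≠ 0) (c₁ c₂ c₃ : ℝ) :
    (Matrix.of fun j k => ∑ i, ∑ l, (radialBlock A + fiberBlock B)⁻¹ i l *
      blockTensor (radialBlock A) (fiberBlock B) c₁ c₂ c₃ ![i, j, k, l])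
      = (2 * (c₁ + c₂)) • radialBlock A + (2 * (c₂ + c₃)) • fiberBlock B := by
  rw [block_inv hB]
  ext j k
  fin_cases j <;> fin_cases k <;>
    simp [blockTensor, kn, invBlock, radialBlock, fiberBlock, Fin.sum_univ_four] <;>
    field_simp <;> ring

theorem trace_block {A B : ℝ} (hB : B ≠ 0) (α β : ℝ) :
    ∑ j, ∑ k, (radialBlock A + fiberBlock B)⁻¹ j k * (α • radialBlock A + β • fiberBlock B) j k
      = 2 * (α + β) := by
  rw [block_inv hB]
  simp [invBlock, radialBlock, fiberBlock, Fin.sum_univ_four]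
  field_simp
  ring

variable (a b q : ℝ) (f : ℝ × ℝ → ℝ)

/-- The `(t, r)`-block of the metric as a field. -/
def radialField : MatrixField 4 := fun x => radialBlock (lapse a b q (x 1))

/-- The `(x³, x⁴)`-block of the metric as a field. -/
def fiberField : MatrixField 4 := fun x => fiberBlock ((x 1) ^ 2 * (1 / f (x 2, x 3) ^ 2))

/-- The Ricci eigenvalue on the `(t, r)`-block. -/
def ricciRadial (b r : ℝ) : ℝ := -(4 * b / r)

/-- The Ricci eigenvalue on the `(x³, x⁴)`-block. -/
def ricciFiber (a b r F : ℝ) : ℝ := (2 * a - 8 * b * r - F) / r ^ 2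

/-- The coefficient of `h ∧ p` in the conformal curvature tensor, which determines that tensor. -/
def weylScalar (a q r F : ℝ) : ℝ := -((2 * a * r - 6 * q - F * r) / (6 * r ^ 3))

/-- The coefficient `κ / 24` in the concircular curvature tensor; `κ` is twice the sum of the two
Ricci eigenvalues. -/
def scalarPart (a b r F : ℝ) : ℝ := (ricciRadial b r + ricciFiber a b r F) / 12

variable {a b q f} {V : Set (ℝ × ℝ)}

theorem metric_eq_add (x : Fin 4 → ℝ) :
    metric a b q f x = radialField a b q x + fiberField f x := metric_eq a b q f x

section

variable (hV : IsOpen V) (hf : ContDiffOn ℝ ∞ f V) (hf0 : ∀ z ∈ V, f z ≠ 0)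
  {x : Fin 4 → ℝ} (hx : x ∈ domain V)

include hf0 hx

theorem fiberEntry_ne_zero : (x 1) ^ 2 * (1 / f (x 2, x 3) ^ 2) ≠ 0 := by
  have hr := hx.1
  have hφ := hf0 _ hx.2
  positivity

theorem isSplitting_metric :
    IsSplitting (metric a b q f x) (radialField a b q x) (fiberField f x) := by
  rw [metric_eq_add]
  exact isSplitting_block (fiberEntry_ne_zero hf0 hx)

include hV hf

theorem riemann_block : riemann (metric a b q f) x
    = blockTensor (radialField a b q x) (fiberField f x) (coeffRadial q (x 1))
        (coeffMixed b q (x 1)) (coeffFiber a b q (x 1) (fiberF f x)) := by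
  rw [riemann_eq hV hf hf0 hx, fiberF_eq hV hf hx]
  rfl

theorem ricci_block : ricci (metric a b q f) x
    = ricciRadial b (x 1) • radialField a b q x
      + ricciFiber a b (x 1) (fiberF f x) • fiberField f x := by
  have h := contract_blockTensor (A := lapse a b q (x 1)) (fiberEntry_ne_zero hf0 hx)
    (coeffRadial q (x 1)) (coeffMixed b q (x 1)) (coeffFiber a b q (x 1) (fiberF f x))
  have hr := hx.1
  have e₁ : 2 * (coeffRadial q (x 1) + coeffMixed b q (x 1)) = ricciRadial b (x 1) := by
    simp only [coeffRadial, coeffMixed, ricciRadial]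
    field_simp
    ring
  have e₂ : 2 * (coeffMixed b q (x 1) + coeffFiber a b q (x 1) (fiberF f x))
      = ricciFiber a b (x 1) (fiberF f x) := by
    simp only [coeffFiber, coeffMixed, ricciFiber]
    field_simp
    ring
  rw [e₁, e₂] at h
  rw [ricci, riemann_block hV hf hf0 hx, metric_eq_add]
  exact h

theorem scalarCurvature_eq : scalarCurvature (metric a b q f) x
    = 24 * scalarPart a b (x 1) (fiberF f x) := by
  have h := trace_block (A := lapse a b q (x 1)) (fiberEntry_ne_zero hf0 hx)
    (ricciRadial b (x 1)) (ricciFiber a b (x 1) (fiberF f x))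
  rw [scalarCurvature, ricci_block hV hf hf0 hx, metric_eq_add]
  refine h.trans ?_
  rw [scalarPart]
  ring

theorem conharmonic_block : conharmonic (metric a b q f) x
    = blockTensor (radialField a b q x) (fiberField f x)
        (coeffRadial q (x 1) - ricciRadial b (x 1) / 2)
        (coeffMixed b q (x 1) - (ricciRadial b (x 1) + ricciFiber a b (x 1) (fiberF f x)) / 2)
        (coeffFiber a b q (x 1) (fiberF f x) - ricciFiber a b (x 1) (fiberF f x) / 2) := by
  rw [conharmonic, riemann_block hV hf hf0 hx, ricci_block hV hf hf0 hx, metric_eq_add,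
    kn_metric_block, sub_eq_add_neg, ← neg_smul, smul_blockTensor, blockTensor_add]
  congr 1 <;> push_cast <;> ring

theorem concircular_block : concircular (metric a b q f) x
    = blockTensor (radialField a b q x) (fiberField f x)
        (coeffRadial q (x 1) - scalarPart a b (x 1) (fiberF f x))
        (coeffMixed b q (x 1) - 2 * scalarPart a b (x 1) (fiberF f x))
        (coeffFiber a b q (x 1) (fiberF f x) - scalarPart a b (x 1) (fiberF f x)) := by
  rw [concircular, riemann_block hV hf hf0 hx, scalarCurvature_eq hV hf hf0 hx, metric_eq_add,
    kn_metric_metric, sub_eq_add_neg, ← neg_smul, smul_blockTensor, blockTensor_add]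
  congr 1 <;> push_cast <;> ring

theorem conformal_block : conformal (metric a b q f) x
    = blockTensor (radialField a b q x) (fiberField f x)
        (-weylScalar a q (x 1) (fiberF f x)) (weylScalar a q (x 1) (fiberF f x))
        (-weylScalar a q (x 1) (fiberF f x)) := by
  have h := conharmonic_block (a := a) (b := b) (q := q) hV hf hf0 hx
  rw [conharmonic] at h
  have hr := hx.1
  rw [conformal, h, scalarCurvature_eq hV hf hf0 hx, metric_eq_add,
    kn_metric_metric, smul_blockTensor, blockTensor_add]
  congr 1 <;> push_cast <;>
    simp only [scalarPart, coeffRadial, coeffMixed, coeffFiber, ricciRadial, ricciFiber,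
      weylScalar] <;>
    field_simp <;> ring

theorem projective_block : projective (metric a b q f) x
    = riemann (metric a b q f) x + (-(1 / 3) : ℝ) • halfKn (metric a b q f x)
      (ricciRadial b (x 1) • radialField a b q x
        + ricciFiber a b (x 1) (fiberF f x) • fiberField f x) := by
  rw [← ricci_block hV hf hf0 hx]
  funext I
  simp only [projective, halfKn, Pi.add_apply, Pi.smul_apply, smul_eq_mul]
  push_cast
  ring

/-- Every curvature tensor of block form acts on each of the tensors `R, S, C, P, W, K` as
`c₂ Q(g, ·)`. -/
theorem pseudosymmetric_all {D : Tensor 4 4} {c₁ c₂ c₃ : ℝ}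
    (hD : D = blockTensor (radialField a b q x) (fiberField f x) c₁ c₂ c₃) :
    let g := metric a b q f
    dot (g x) D (riemann g x) = c₂ • tachibana (g x) (riemann g x) ∧
    dot (g x) D (tensorOfMatrix (ricci g x)) = c₂ • tachibana (g x) (tensorOfMatrix (ricci g x)) ∧
    dot (g x) D (conformal g x) = c₂ • tachibana (g x) (conformal g x) ∧
    dot (g x) D (projective g x) = c₂ • tachibana (g x) (projective g x) ∧
    dot (g x) D (concircular g x) = c₂ • tachibana (g x) (concircular g x) ∧
    dot (g x) D (conharmonic g x) = c₂ • tachibana (g x) (conharmonic g x) := by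
  intro g
  have s : IsSplitting (g x) (radialField a b q x) (fiberField f x) := isSplitting_metric hf0 hx
  rw [hD]
  refine ⟨?_, ?_, ?_, ?_, ?_, ?_⟩ <;> refine s.dot_blockTensor _ _ _ _ fun T hh hp => ?_
  · rw [riemann_block hV hf hf0 hx, IsSplitting.act_blockTensor hh hp]
  · rw [ricci_block hV hf hf0 hx, IsSplitting.act_matrix hh hp]
  · rw [conformal_block hV hf hf0 hx, IsSplitting.act_blockTensor hh hp]
  · rw [projective_block hV hf hf0 hx, act_add_right, act_smul_right, s.act_halfKn_eq_zero hh hp,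
      riemann_block hV hf hf0 hx, IsSplitting.act_blockTensor hh hp, smul_zero, add_zero]
  · rw [concircular_block hV hf hf0 hx, IsSplitting.act_blockTensor hh hp]
  · rw [conharmonic_block hV hf hf0 hx, IsSplitting.act_blockTensor hh hp]

end

end

section

/-! ### Covariant derivatives and the exterior derivative of curvature forms -/

section General

variable {n k : ℕ}

/-- The matrix of the endomorphism `∂ⱼ ↦ ∇ᵢ ∂ⱼ` of the coordinate fields. -/
def christoffelEndo (g : MatrixField n) (i : Fin n) (x : Fin n → ℝ) : Matrix (Fin n) (Fin n) ℝ :=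
  Matrix.of fun s j => christoffel g s i j x

theorem covDeriv_eq_sub_act (g : MatrixField n) (H : TensorField n k) (i : Fin n)
    (x : Fin n → ℝ) (I : Fin k → Fin n) :
    covDeriv g H i x I = pd i (fun y => H y I) x - act (christoffelEndo g i x) (H x) I := rfl

theorem covDeriv_congr (g : MatrixField n) {H H' : TensorField n k} {x : Fin n → ℝ}
    (h : H =ᶠ[nhds x] H') (i : Fin n) : covDeriv g H i x = covDeriv g H' i x := by
  funext I
  have h1 : (fun y => H y I) =ᶠ[nhds x] fun y => H' y I := by
    filter_upwards [h] with y hy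
    rw [hy]
  rw [covDeriv_eq_sub_act, covDeriv_eq_sub_act, pd_congr h1, h.eq_of_nhds]

theorem covDeriv_add (g : MatrixField n) {H H' : TensorField n k} {x : Fin n → ℝ}
    (hH : ∀ I, DifferentiableAt ℝ (fun y => H y I) x)
    (hH' : ∀ I, DifferentiableAt ℝ (fun y => H' y I) x) (i : Fin n) :
    covDeriv g (fun y => H y + H' y) i x = covDeriv g H i x + covDeriv g H' i x := by
  funext I
  have h := pd_add (hH I) (hH' I) i
  simp only [covDeriv_eq_sub_act, Pi.add_apply, act_add_right, h]
  ring

theorem covDeriv_smul (g : MatrixField n) {w : Scalar n} {H : TensorField n k} {x : Fin n → ℝ}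
    (hw : DifferentiableAt ℝ w x) (hH : ∀ I, DifferentiableAt ℝ (fun y => H y I) x) (i : Fin n) :
    covDeriv g (fun y => w y • H y) i x = pd i w x • H x + w x • covDeriv g H i x := by
  funext I
  have h := pd_mul hw (hH I) i
  simp only [covDeriv_eq_sub_act, Pi.add_apply, Pi.smul_apply, smul_eq_mul, act_smul_right, h]
  ring

theorem differentiableAt_kn {A E : MatrixField n} {x : Fin n → ℝ}
    (hA : ∀ j k, DifferentiableAt ℝ (fun y => A y j k) x)
    (hE : ∀ j k, DifferentiableAt ℝ (fun y => E y j k) x) (I : Fin 4 → Fin n) :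
    DifferentiableAt ℝ (fun y => kn (A y) (E y) I) x :=
  ((((hA _ _).mul (hE _ _)).add ((hA _ _).mul (hE _ _))).sub ((hA _ _).mul (hE _ _))).sub
    ((hA _ _).mul (hE _ _))

/-- The Leibniz rule for a Kulkarni-Nomizu product; `N` and `N'` are the covariant derivatives of
the two factors. -/
theorem covDeriv_kn {g A E : MatrixField n} {x : Fin n → ℝ} {i : Fin n}
    {N N' : Matrix (Fin n) (Fin n) ℝ}
    (hA : ∀ j k, DifferentiableAt ℝ (fun y => A y j k) x)
    (hE : ∀ j k, DifferentiableAt ℝ (fun y => E y j k) x)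
    (hN : ∀ j k, pd i (fun y => A y j k) x = (actMat (christoffelEndo g i x) (A x) + N) j k)
    (hN' : ∀ j k, pd i (fun y => E y j k) x = (actMat (christoffelEndo g i x) (E x) + N') j k) :
    covDeriv g (fun y => kn (A y) (E y)) i x = kn N (E x) + kn (A x) N' := by
  funext I
  have hpd : pd i (fun y => kn (A y) (E y) I) x
      = (kn (actMat (christoffelEndo g i x) (A x) + N) (E x)
        + kn (A x) (actMat (christoffelEndo g i x) (E x) + N')) I := by
    simp only [kn, Pi.add_apply, ← hN, ← hN']
    rw [pd_sub, pd_sub, pd_add, pd_mul (hA _ _) (hE _ _), pd_mul (hA _ _) (hE _ _),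
      pd_mul (hA _ _) (hE _ _), pd_mul (hA _ _) (hE _ _)]
    · ring
    all_goals first
      | exact (hA _ _).mul (hE _ _)
      | exact ((hA _ _).mul (hE _ _)).add ((hA _ _).mul (hE _ _))
      | exact (((hA _ _).mul (hE _ _)).add ((hA _ _).mul (hE _ _))).sub ((hA _ _).mul (hE _ _))
  rw [covDeriv_eq_sub_act, hpd, act_kn, kn_add_left, kn_add_right]
  simp only [Pi.add_apply]
  ring

end General

theorem covDeriv_four {n : ℕ} (g : MatrixField n) (H : TensorField n 4) (i : Fin n)
    (x : Fin n → ℝ) (j k l m : Fin n) :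
    covDeriv g H i x ![j, k, l, m] = pd i (fun y => H y ![j, k, l, m]) x
      - ((∑ s, christoffel g s i j x * H x ![s, k, l, m])
        + (∑ s, christoffel g s i k x * H x ![j, s, l, m])
        + (∑ s, christoffel g s i l x * H x ![j, k, s, m])
        + ∑ s, christoffel g s i m x * H x ![j, k, l, s]) := by
  have u0 : ∀ s, Function.update ![j, k, l, m] 0 s = ![s, k, l, m] := by
    intro s; funext t; fin_cases t <;> simp [Function.update]
  have u1 : ∀ s, Function.update ![j, k, l, m] 1 s = ![j, s, l, m] := by
    intro s; funext t; fin_cases t <;> simp [Function.update]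
  have u2 : ∀ s, Function.update ![j, k, l, m] 2 s = ![j, k, s, m] := by
    intro s; funext t; fin_cases t <;> simp [Function.update]
  have u3 : ∀ s, Function.update ![j, k, l, m] 3 s = ![j, k, l, s] := by
    intro s; funext t; fin_cases t <;> simp [Function.update]
  simp only [covDeriv, Fin.sum_univ_four, u0, u1, u2, u3, Matrix.cons_val]

/-- If the inverse metric is parallel, the exterior covariant derivative of the curvature forms is
obtained from `∇D` by raising an index, up to terms that cancel in the cyclic sum. -/
theorem connDeriv_eq {g : MatrixField 4} {D : TensorField 4 4} {x : Fin 4 → ℝ}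
    (hg : ∀ m p, DifferentiableAt ℝ (fun y => (g y)⁻¹ m p) x)
    (hD : ∀ I, DifferentiableAt ℝ (fun y => D y I) x)
    (hpar : ∀ i m p, pd i (fun y => (g y)⁻¹ m p) x
      = -∑ s, (christoffel g m i s x * (g x)⁻¹ s p + christoffel g p i s x * (g x)⁻¹ m s))
    (i j k l m : Fin 4) :
    connDeriv g D i j k l m x = ∑ p, (g x)⁻¹ m p * (covDeriv g D i x ![j, k, l, p]
      + ∑ s, (christoffel g s i j x * D x ![s, k, l, p]
        + christoffel g s i k x * D x ![j, s, l, p])) := by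
  have hpd : pd i (curvatureForm g D j k l m) x
      = ∑ p, (pd i (fun y => (g y)⁻¹ m p) x * D x ![j, k, l, p]
        + (g x)⁻¹ m p * pd i (fun y => D y ![j, k, l, p]) x) := by
    have := pd_sum Finset.univ (φ := fun p y => (g y)⁻¹ m p * D y ![j, k, l, p])
      (fun p _ => (hg m p).mul (hD _)) i
    rw [show curvatureForm g D j k l m = fun y => ∑ p, (g y)⁻¹ m p * D y ![j, k, l, p] from rfl,
      this]
    exact Finset.sum_congr rfl fun p _ => pd_mul (hg m p) (hD _) i
  rw [connDeriv, hpd]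
  simp only [hpar, curvatureForm, covDeriv_four, Fin.sum_univ_four]
  ring

/-- The cyclic recurrence of a tensor implies the recurrence of its curvature forms. -/
theorem isRecurrentForm_of_cyclic {M : Set (Fin 4 → ℝ)} {g : MatrixField 4}
    {D : TensorField 4 4} {η : OneForm 4}
    (hg : ∀ x ∈ M, ∀ m p, DifferentiableAt ℝ (fun y => (g y)⁻¹ m p) x)
    (hD : ∀ x ∈ M, ∀ I, DifferentiableAt ℝ (fun y => D y I) x)
    (hpar : ∀ x ∈ M, ∀ i m p, pd i (fun y => (g y)⁻¹ m p) x
      = -∑ s, (christoffel g m i s x * (g x)⁻¹ s p + christoffel g p i s x * (g x)⁻¹ m s))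
    (hsymm : ∀ x ∈ M, ∀ s i j, christoffel g s i j x = christoffel g s j i x)
    (hskew : ∀ x ∈ M, ∀ i j k l, D x ![i, j, k, l] = -D x ![j, i, k, l])
    (hcyc : SatisfiesCyclicRecurrence M g D η) : IsRecurrentForm M g D η := by
  intro x hx i j k l m
  simp only [connDeriv_eq (hg x hx) (hD x hx) (hpar x hx), curvatureForm, Finset.mul_sum,
    ← Finset.sum_add_distrib]
  refine Finset.sum_congr rfl fun p _ => ?_
  have h := hcyc x hx i j k l p
  have hc : ∀ u v w : Fin 4, ∑ s, christoffel g s u v x * D x ![s, w, l, p]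
      = -∑ s, christoffel g s v u x * D x ![w, s, l, p] := by
    intro u v w
    rw [← Finset.sum_neg_distrib]
    refine Finset.sum_congr rfl fun s _ => ?_
    rw [hsymm x hx s u v, hskew x hx s w]
    ring
  -- By the symmetry of `Γ` and the skew-symmetry of `D`, the connection terms cancel in pairs.
  have h1 := hc i j k
  have h2 := hc j k i
  have h3 := hc k i j
  simp only [Finset.sum_add_distrib]
  rw [h1, h2, h3]
  linear_combination (g x)⁻¹ m p * h

/-! ### The covariant derivative of the conformal tensor -/

variable {a b q : ℝ} {f : ℝ × ℝ → ℝ} {V : Set (ℝ × ℝ)}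

/-- The components of the 1-form `dr / r`. -/
def logRadial (x : Fin 4 → ℝ) : Fin 4 → ℝ := ![0, 1 / x 1, 0, 0]

/-- The covariant derivative `∇ᵢ h = pᵢ ⊗ (dr / r) + (dr / r) ⊗ pᵢ` of the radial block. -/
def blockDeriv (f : ℝ × ℝ → ℝ) (x : Fin 4 → ℝ) (i : Fin 4) : Matrix (Fin 4) (Fin 4) ℝ :=
  Matrix.of fun j k => fiberField f x i k * logRadial x j + fiberField f x i j * logRadial x k

set_option maxHeartbeats 2000000 in
theorem pd_radialField (hV : IsOpen V) (hf : ContDiffOn ℝ ∞ f V) (hf0 : ∀ z ∈ V, f z ≠ 0)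
    {x : Fin 4 → ℝ} (hx : x ∈ domain V) (i j k : Fin 4) :
    pd i (fun y => radialField a b q y j k) x
      = (actMat (christoffelEndo (metric a b q f) i x) (radialField a b q x)
        + blockDeriv f x i) j k := by
  have hd := (pd_metric (a := a) (b := b) (q := q) hV hf hf0 hx i).1
  have hr := hx.1
  have hφ := hf0 _ hx.2
  have hb := (pd_blocks (fun y => lapse a b q (y 1))
    (fun y => (y 1) ^ 2 * (1 / f (y 2, y 3) ^ 2)) x i j k).1
  rw [hd] at hb
  refine hb.trans ?_
  clear hb hd
  simp only [actMat, Matrix.add_apply, Matrix.mul_apply, Matrix.transpose_apply, christoffelEndo,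
    Matrix.of_apply, christoffel_eq hV hf hf0 hx, christoffelEntries_eq, blockDeriv,
    Fin.sum_univ_four, logRadial, radialField, fiberField]
  generalize lapse a b q (x 1) = A
  generalize dirDeriv (1, 0) f (x 2, x 3) = u
  generalize dirDeriv (0, 1) f (x 2, x 3) = v
  generalize f (x 2, x 3) = φ at *
  generalize x 1 = r at *
  clear hx hf hf0
  fin_cases i <;> fin_cases j <;> fin_cases k <;>
    simp [christoffelArray, radialBlock, fiberBlock] <;> field_simp <;> ring

set_option maxHeartbeats 2000000 in
theorem pd_fiberField (hV : IsOpen V) (hf : ContDiffOn ℝ ∞ f V) (hf0 : ∀ z ∈ V, f z ≠ 0)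
    {x : Fin 4 → ℝ} (hx : x ∈ domain V) (i j k : Fin 4) :
    pd i (fun y => fiberField f y j k) x
      = (actMat (christoffelEndo (metric a b q f) i x) (fiberField f x)
        + -blockDeriv f x i) j k := by
  have hd := (pd_metric (a := a) (b := b) (q := q) hV hf hf0 hx i).2
  have hr := hx.1
  have hφ := hf0 _ hx.2
  have hb := (pd_blocks (fun y => lapse a b q (y 1))
    (fun y => (y 1) ^ 2 * (1 / f (y 2, y 3) ^ 2)) x i j k).2.1
  rw [hd] at hb
  refine hb.trans ?_
  clear hb hd
  simp only [actMat, Matrix.add_apply, Matrix.mul_apply, Matrix.transpose_apply, christoffelEndo,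
    Matrix.of_apply, christoffel_eq hV hf hf0 hx, christoffelEntries_eq, blockDeriv,
    Matrix.neg_apply, Fin.sum_univ_four, logRadial, fiberField]
  generalize lapse a b q (x 1) = A
  generalize dirDeriv (1, 0) f (x 2, x 3) = u
  generalize dirDeriv (0, 1) f (x 2, x 3) = v
  generalize f (x 2, x 3) = φ at *
  generalize x 1 = r at *
  clear hx hf hf0
  fin_cases i <;> fin_cases j <;> fin_cases k <;>
    simp [christoffelArray, fiberBlock] <;> field_simp <;> ring

theorem differentiableAt_blockField (hV : IsOpen V) (hf : ContDiffOn ℝ ∞ f V)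
    (hf0 : ∀ z ∈ V, f z ≠ 0) {x : Fin 4 → ℝ} (hx : x ∈ domain V) (j k : Fin 4) :
    DifferentiableAt ℝ (fun y => radialField a b q y j k) x ∧
    DifferentiableAt ℝ (fun y => fiberField f y j k) x ∧
    DifferentiableAt ℝ (fun y => (metric a b q f y)⁻¹ j k) x := by
  have h1 : DifferentiableAt ℝ (fun y : Fin 4 → ℝ => lapse a b q (y 1)) x := by
    have h := differentiableAt_radial_mul_fiber (hasDerivAt_lapse a b q hx.1)
      (differentiableAt_const (1 : ℝ) : DifferentiableAt ℝ (fun _ => (1 : ℝ)) (x 2, x 3))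
    simpa only [mul_one] using h
  have h2 : DifferentiableAt ℝ
      (fun y : Fin 4 → ℝ => (y 1) ^ 2 * (1 / f (y 2, y 3) ^ 2)) x :=
    differentiableAt_radial_mul_fiber (hasDerivAt_pow 2 (x 1))
      (differentiableAt_fiberFactor hV hf hf0 hx.2 2)
  have h3 := h2.inv (fiberEntry_ne_zero hf0 hx)
  have e : (fun y => (metric a b q f y)⁻¹ j k) =ᶠ[nhds x]
      fun y => invBlock (lapse a b q (y 1)) ((y 1) ^ 2 * (1 / f (y 2, y 3) ^ 2)) j k := by
    filter_upwards [(isOpen_domain hV).mem_nhds hx] with y hy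
    rw [metric_eq, block_inv (fiberEntry_ne_zero hf0 hy)]
  refine ⟨?_, ?_, DifferentiableAt.congr_of_eventuallyEq ?_ e⟩
  · fin_cases j <;> fin_cases k <;> first
      | exact differentiableAt_const _
      | exact h1
  · fin_cases j <;> fin_cases k <;> first
      | exact differentiableAt_const _
      | exact h2.neg
  · fin_cases j <;> fin_cases k <;> first
      | exact differentiableAt_const _
      | exact h1.neg
      | exact h3.neg

end

section

theorem pd_inv {n : ℕ} {β : Scalar n} {x : Fin n → ℝ} (hβ : DifferentiableAt ℝ β x) (h0 : β x ≠ 0)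
    (i : Fin n) : pd i (fun y => (β y)⁻¹) x = -pd i β x / β x ^ 2 := by
  have h : HasFDerivAt (fun y => (β y)⁻¹) _ x :=
    (hasDerivAt_inv h0).comp_hasFDerivAt x hβ.hasFDerivAt
  rw [pd, h.fderiv, pd]
  simp [div_eq_mul_inv, mul_comm]

variable {a b q : ℝ} {f : ℝ × ℝ → ℝ} {V : Set (ℝ × ℝ)}

theorem pd_invBlock {α β : Scalar 4} {x : Fin 4 → ℝ} (hβ : DifferentiableAt ℝ β x) (h0 : β x ≠ 0)
    (i j k : Fin 4) :
    pd i (fun y => invBlock (α y) (β y) j k) x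
      = !![0, 0, 0, 0; 0, -pd i α x, 0, 0; 0, 0, pd i β x / β x ^ 2, 0;
          0, 0, 0, pd i β x / β x ^ 2] j k := by
  fin_cases j <;> fin_cases k <;>
    simp [invBlock, pd_const, pd_neg, pd_inv hβ h0, neg_div]

set_option maxHeartbeats 2000000 in
/-- The inverse metric is parallel. -/
theorem pd_metric_inv (hV : IsOpen V) (hf : ContDiffOn ℝ ∞ f V) (hf0 : ∀ z ∈ V, f z ≠ 0)
    {x : Fin 4 → ℝ} (hx : x ∈ domain V) (i m p : Fin 4) :
    pd i (fun y => (metric a b q f y)⁻¹ m p) x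
      = -∑ s, (christoffel (metric a b q f) m i s x * (metric a b q f x)⁻¹ s p
          + christoffel (metric a b q f) p i s x * (metric a b q f x)⁻¹ m s) := by
  have e : (fun y => (metric a b q f y)⁻¹ m p) =ᶠ[nhds x]
      fun y => invBlock (lapse a b q (y 1)) ((y 1) ^ 2 * (1 / f (y 2, y 3) ^ 2)) m p := by
    filter_upwards [(isOpen_domain hV).mem_nhds hx] with y hy
    rw [metric_eq, block_inv (fiberEntry_ne_zero hf0 hy)]
  have h2 : DifferentiableAt ℝ
      (fun y : Fin 4 → ℝ => (y 1) ^ 2 * (1 / f (y 2, y 3) ^ 2)) x :=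
    differentiableAt_radial_mul_fiber (hasDerivAt_pow 2 (x 1))
      (differentiableAt_fiberFactor hV hf hf0 hx.2 2)
  have hd := pd_metric (a := a) (b := b) (q := q) hV hf hf0 hx i
  have hr := hx.1
  have hφ := hf0 _ hx.2
  rw [pd_congr e, pd_invBlock h2 (fiberEntry_ne_zero hf0 hx), hd.1, hd.2]
  simp only [metric_eq, block_inv (fiberEntry_ne_zero hf0 hx), christoffel_eq hV hf hf0 hx,
    christoffelEntries_eq, Fin.sum_univ_four]
  generalize lapse a b q (x 1) = A
  generalize dirDeriv (1, 0) f (x 2, x 3) = u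
  generalize dirDeriv (0, 1) f (x 2, x 3) = v
  clear e h2 hd
  generalize f (x 2, x 3) = φ at *
  generalize x 1 = r at *
  clear hx hf hf0
  fin_cases i <;> fin_cases m <;> fin_cases p <;>
    simp [christoffelArray, invBlock] <;> field_simp <;> ring

theorem christoffel_symm (hV : IsOpen V) (hf : ContDiffOn ℝ ∞ f V) (hf0 : ∀ z ∈ V, f z ≠ 0)
    {x : Fin 4 → ℝ} (hx : x ∈ domain V) (s i j : Fin 4) :
    christoffel (metric a b q f) s i j x = christoffel (metric a b q f) s j i x := by
  rw [christoffel_eq hV hf hf0 hx, christoffel_eq hV hf hf0 hx]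
  fin_cases s <;> fin_cases i <;> fin_cases j <;> rfl

theorem blockTensor_skew {n : ℕ} (h p : Matrix (Fin n) (Fin n) ℝ) (c₁ c₂ c₃ : ℝ)
    (i j k l : Fin n) :
    blockTensor h p c₁ c₂ c₃ ![i, j, k, l] = -blockTensor h p c₁ c₂ c₃ ![j, i, k, l] := by
  simp only [blockTensor, kn, Pi.add_apply, Pi.smul_apply, smul_eq_mul, Matrix.cons_val]
  ring

/-- The covariant derivative of the constant-coefficient tensor `h ∧ p - h ∧ h - p ∧ p`, of which
the conformal tensor is a multiple. -/
theorem covDeriv_weylShape (hV : IsOpen V) (hf : ContDiffOn ℝ ∞ f V) (hf0 : ∀ z ∈ V, f z ≠ 0)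
    {x : Fin 4 → ℝ} (hx : x ∈ domain V) (i : Fin 4) :
    covDeriv (metric a b q f)
        (fun y => blockTensor (radialField a b q y) (fiberField f y) (-1) 1 (-1)) i x
      = (3 : ℝ) • (kn (blockDeriv f x i) (fiberField f x)
          - kn (blockDeriv f x i) (radialField a b q x)) := by
  have hh := fun j k => (differentiableAt_blockField (a := a) (b := b) (q := q) hV hf hf0 hx j k).1
  have hp := fun j k =>
    (differentiableAt_blockField (a := a) (b := b) (q := q) hV hf hf0 hx j k).2.1
  have dh := pd_radialField (a := a) (b := b) (q := q) hV hf hf0 hx i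
  have dp := pd_fiberField (a := a) (b := b) (q := q) hV hf hf0 hx i
  have e₁ := covDeriv_kn hh hh dh dh
  have e₂ := covDeriv_kn hh hp dh dp
  have e₃ := covDeriv_kn hp hp dp dp
  have hc : ∀ c : ℝ, DifferentiableAt ℝ (fun _ : Fin 4 → ℝ => c) x := fun c =>
    differentiableAt_const c
  have d₁ := differentiableAt_kn hh hh
  have d₂ := differentiableAt_kn hh hp
  have d₃ := differentiableAt_kn hp hp
  have c₁ : ∀ I, DifferentiableAt ℝ
      (fun y => ((-1 : ℝ) • kn (radialField a b q y) (radialField a b q y)) I) x :=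
    fun I => (d₁ I).const_mul (-1)
  have c₂ : ∀ I, DifferentiableAt ℝ
      (fun y => ((1 : ℝ) • kn (radialField a b q y) (fiberField f y)) I) x :=
    fun I => (d₂ I).const_mul 1
  have c₃ : ∀ I, DifferentiableAt ℝ
      (fun y => ((-1 : ℝ) • kn (fiberField f y) (fiberField f y)) I) x :=
    fun I => (d₃ I).const_mul (-1)
  have c₁₂ : ∀ I, DifferentiableAt ℝ
      (fun y => ((-1 : ℝ) • kn (radialField a b q y) (radialField a b q y)
        + (1 : ℝ) • kn (radialField a b q y) (fiberField f y)) I) x :=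
    fun I => (c₁ I).fun_add (c₂ I)
  simp only [blockTensor]
  rw [covDeriv_add _ c₁₂ c₃, covDeriv_add _ c₁ c₂,
    covDeriv_smul _ (hc _) d₁, covDeriv_smul _ (hc _) d₂, covDeriv_smul _ (hc _) d₃, e₁, e₂, e₃,
    pd_const, pd_const]
  have hneg : ∀ A E : Matrix (Fin 4) (Fin 4) ℝ, kn (-A) E = -kn A E := fun A E => by
    have := kn_smul_left (-1) A E
    simpa using this
  rw [kn_comm (radialField a b q x) (blockDeriv f x i),
    kn_comm (radialField a b q x) (-blockDeriv f x i),
    kn_comm (fiberField f x) (-blockDeriv f x i), hneg, hneg]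
  module

/-- Since `dr` belongs to the two-dimensional radial block, antisymmetrisation of three of its
indices annihilates `dr ⊗ (h ∧ h)`. -/
theorem cyclic_logRadial_radial (x : Fin 4 → ℝ) (i j k l m : Fin 4) :
    logRadial x i * kn (radialField a b q x) (radialField a b q x) ![j, k, l, m]
      + logRadial x j * kn (radialField a b q x) (radialField a b q x) ![k, i, l, m]
      + logRadial x k * kn (radialField a b q x) (radialField a b q x) ![i, j, l, m] = 0 := by
  simp only [kn, radialField, logRadial, Matrix.cons_val]
  have hz : ∀ s, ![(0 : ℝ), 0, 0, 0] s = 0 := by intro s; fin_cases s <;> rfl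
  fin_cases i <;> fin_cases j <;> fin_cases k <;> simp [radialBlock, hz] <;> ring

/-- The cyclic sum of the covariant derivative of `h ∧ p - h ∧ h - p ∧ p` is that of its product
with `3 dr / r`. -/
theorem cyclic_weylShape {V : Set (ℝ × ℝ)} (hf0 : ∀ z ∈ V, f z ≠ 0) {x : Fin 4 → ℝ}
    (hx : x ∈ domain V) (i j k l m : Fin 4) :
    let N := fun i => kn (blockDeriv f x i) (fiberField f x)
      - kn (blockDeriv f x i) (radialField a b q x)
    let Z := blockTensor (radialField a b q x) (fiberField f x) (-1) 1 (-1)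
    N i ![j, k, l, m] + N j ![k, i, l, m] + N k ![i, j, l, m]
      = logRadial x i * Z ![j, k, l, m] + logRadial x j * Z ![k, i, l, m]
        + logRadial x k * Z ![i, j, l, m] := by
  intro N Z
  have h0 := cyclic_logRadial_radial (a := a) (b := b) (q := q) x i j k l m
  have s : IsSplitting (metric a b q f x) _ _ := isSplitting_metric hf0 hx
  have hs := s.symm_left.apply
  have ps := s.symm_right.apply
  simp only [kn, Matrix.cons_val] at h0
  simp only [N, Z, blockTensor, kn, Pi.add_apply, Pi.sub_apply, Pi.smul_apply, smul_eq_mul,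
    Matrix.cons_val, blockDeriv, Matrix.of_apply]
  rw [ps i j, ps i k, ps j k]
  linear_combination h0

/-- `d(weylScalar) = weylScalar (η - 3 dr / r)` for the recurrence form
`η = d log |(-2a + F) r + 6q|`. -/
theorem pd_weylScalar (hV : IsOpen V) (hf : ContDiffOn ℝ ∞ f V)
    {x : Fin 4 → ℝ} (hx : x ∈ domain V)
    (hD : -2 * a * x 1 + 6 * q + fiberF f x * x 1 ≠ 0) (i : Fin 4) :
    DifferentiableAt ℝ (fun y => weylScalar a q (y 1) (fiberF f y)) x ∧
    pd i (fun y => weylScalar a q (y 1) (fiberF f y)) x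
      = weylScalar a q (x 1) (fiberF f x) *
        (![0, (fiberF f x - 2 * a) / (-2 * a * x 1 + 6 * q + fiberF f x * x 1),
          pd 2 (fiberF f) x * x 1 / (-2 * a * x 1 + 6 * q + fiberF f x * x 1),
          pd 3 (fiberF f) x * x 1 / (-2 * a * x 1 + 6 * q + fiberF f x * x 1)] i
          - 3 * logRadial x i) := by
  have hr := hx.1
  have e : (fun y => weylScalar a q (y 1) (fiberF f y)) =ᶠ[nhds x]
      fun y => (q * (y 1 ^ 3)⁻¹ - a / 3 * (y 1 ^ 2)⁻¹) * (fun _ : ℝ × ℝ => (1 : ℝ)) (y 2, y 3)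
        + (1 / 6 * (y 1 ^ 2)⁻¹) * fiberCurv f (y 2, y 3) := by
    filter_upwards [(isOpen_domain hV).mem_nhds hx] with y hy
    have hy1 := hy.1
    rw [fiberF_eq hV hf hy, weylScalar]
    field_simp
    ring
  have i2 : HasDerivAt (fun r : ℝ => (r ^ 2)⁻¹) (-2 / x 1 ^ 3) (x 1) := by
    refine ((hasDerivAt_pow 2 (x 1)).inv (pow_ne_zero 2 hr)).congr_deriv ?_
    simp
    field_simp
  have i3 : HasDerivAt (fun r : ℝ => (r ^ 3)⁻¹) (-3 / x 1 ^ 4) (x 1) := by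
    refine ((hasDerivAt_pow 3 (x 1)).inv (pow_ne_zero 3 hr)).congr_deriv ?_
    simp
    field_simp
  have g1 : HasDerivAt (fun r : ℝ => q * (r ^ 3)⁻¹ - a / 3 * (r ^ 2)⁻¹) _ (x 1) :=
    (i3.const_mul q).sub (i2.const_mul (a / 3))
  have g2 : HasDerivAt (fun r : ℝ => 1 / 6 * (r ^ 2)⁻¹) _ (x 1) := i2.const_mul (1 / 6)
  have c1 : DifferentiableAt ℝ (fun _ : ℝ × ℝ => (1 : ℝ)) (x 2, x 3) := differentiableAt_const 1
  have c2 := differentiableAt_of_contDiffOn hV (contDiffOn_fiberCurv hV hf) hx.2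
  have d1 := differentiableAt_radial_mul_fiber g1 c1
  have d2 := differentiableAt_radial_mul_fiber g2 c2
  refine ⟨(d1.fun_add d2).congr_of_eventuallyEq e, ?_⟩
  rw [pd_congr e, pd_add d1 d2, pd_radial_mul_fiber g1 c1, pd_radial_mul_fiber g2 c2,
    pd_fiberF hV hf hx, pd_fiberF hV hf hx, ← fiberF_eq hV hf hx]
  have hone : ∀ v z, dirDeriv v (fun _ : ℝ × ℝ => (1 : ℝ)) z = 0 := by simp [dirDeriv]
  simp only [hone, logRadial, weylScalar]
  generalize fiberF f x = F at *
  generalize x 1 = r at *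
  clear e d1 d2 g1 g2 i2 i3
  -- Eliminating `q` in favour of the denominator `D` leaves rational identities with monomial
  -- denominators.
  generalize hDe : -2 * a * r + 6 * q + F * r = D at *
  have hq : q = (D + 2 * a * r - F * r) / 6 := by linarith
  fin_cases i
  · simp
  all_goals
    simp
    rw [hq]
    field_simp
    ring

theorem conformal_eq_smul (hV : IsOpen V) (hf : ContDiffOn ℝ ∞ f V) (hf0 : ∀ z ∈ V, f z ≠ 0)
    {x : Fin 4 → ℝ} (hx : x ∈ domain V) : conformal (metric a b q f) x
      = weylScalar a q (x 1) (fiberF f x)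
        • blockTensor (radialField a b q x) (fiberField f x) (-1) 1 (-1) := by
  rw [conformal_block hV hf hf0 hx, smul_blockTensor]
  simp

theorem conformal_cyclicRecurrence (hV : IsOpen V) (hf : ContDiffOn ℝ ∞ f V)
    (hf0 : ∀ z ∈ V, f z ≠ 0) {M : Set (Fin 4 → ℝ)} (hM : M ⊆ domain V)
    (hD : ∀ x ∈ M, -2 * a * x 1 + 6 * q + fiberF f x * x 1 ≠ 0) :
    let η : OneForm 4 := fun x =>
      ![0, (fiberF f x - 2 * a) / (-2 * a * x 1 + 6 * q + fiberF f x * x 1),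
        pd 2 (fiberF f) x * x 1 / (-2 * a * x 1 + 6 * q + fiberF f x * x 1),
        pd 3 (fiberF f) x * x 1 / (-2 * a * x 1 + 6 * q + fiberF f x * x 1)]
    IsRecurrentForm M (metric a b q f) (conformal (metric a b q f)) η ∧
      SatisfiesCyclicRecurrence M (metric a b q f) (conformal (metric a b q f)) η := by
  intro η
  have hZ : ∀ x ∈ M, ∀ I, DifferentiableAt ℝ
      (fun y => blockTensor (radialField a b q y) (fiberField f y) (-1) 1 (-1) I) x := by
    intro x hx I
    have hh := fun j k =>
      (differentiableAt_blockField (a := a) (b := b) (q := q) hV hf hf0 (hM hx) j k).1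
    have hp := fun j k =>
      (differentiableAt_blockField (a := a) (b := b) (q := q) hV hf hf0 (hM hx) j k).2.1
    exact (((differentiableAt_kn hh hh I).const_mul (-1)).add
      ((differentiableAt_kn hh hp I).const_mul 1)).add ((differentiableAt_kn hp hp I).const_mul (-1))
  have e : ∀ x ∈ M, conformal (metric a b q f) =ᶠ[nhds x] fun y =>
      weylScalar a q (y 1) (fiberF f y)
        • blockTensor (radialField a b q y) (fiberField f y) (-1) 1 (-1) := by
    intro x hx
    filter_upwards [(isOpen_domain hV).mem_nhds (hM hx)] with y hy
    exact conformal_eq_smul hV hf hf0 hy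
  have hcyc : SatisfiesCyclicRecurrence M (metric a b q f) (conformal (metric a b q f)) η := by
    intro x hx i j k l m
    have hw := fun i => (pd_weylScalar (a := a) (q := q) hV hf (hM hx) (hD x hx) i)
    have key := cyclic_weylShape (a := a) (b := b) (q := q) hf0 (hM hx) i j k l m
    simp only [covDeriv_congr _ (e x hx), covDeriv_smul _ (hw 0).1 (hZ x hx),
      covDeriv_weylShape hV hf hf0 (hM hx), (hw _).2, conformal_eq_smul hV hf hf0 (hM hx),
      Pi.add_apply, Pi.smul_apply, smul_eq_mul]
    simp only at key
    linear_combination 3 * weylScalar a q (x 1) (fiberF f x) * key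
  refine ⟨isRecurrentForm_of_cyclic ?_ ?_ ?_ ?_ ?_ hcyc, hcyc⟩
  · exact fun x hx j k => (differentiableAt_blockField hV hf hf0 (hM hx) j k).2.2
  · intro x hx I
    have hw := (pd_weylScalar (a := a) (q := q) hV hf (hM hx) (hD x hx) 0).1
    refine (hw.fun_mul (hZ x hx I)).congr_of_eventuallyEq ?_
    filter_upwards [e x hx] with y hy
    rw [hy]
    rfl
  · exact fun x hx => pd_metric_inv hV hf hf0 (hM hx)
  · exact fun x hx => christoffel_symm hV hf hf0 (hM hx)
  · intro x hx i j k l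
    rw [conformal_block hV hf hf0 (hM hx)]
    exact blockTensor_skew _ _ _ _ _ _ _ _ _

end

section

variable {a b q : ℝ} {f : ℝ × ℝ → ℝ} {V : Set (ℝ × ℝ)}

/-! ### Relations between the Tachibana tensors of the metric -/

/-- On the line through a point of `M` in the `r`-direction, constancy would give the polynomial
`c X³ + 2 b X² - q` infinitely many zeros. -/
theorem coeffMixed_not_constant {M : Set (Fin 4 → ℝ)} (hM : IsOpen M) (hne : M.Nonempty)
    (hM1 : ∀ x ∈ M, x 1 ≠ 0) (hbq : ¬(b = 0 ∧ q = 0)) :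
    ¬∃ c : ℝ, ∀ x ∈ M, (q - 2 * b * x 1 ^ 2) / x 1 ^ 3 = c := by
  rintro ⟨c, hc⟩
  obtain ⟨y, hy⟩ := hne
  have hcont : Continuous fun r : ℝ => Function.update y 1 r := by fun_prop
  have hinf : {r : ℝ | Function.update y 1 r ∈ M}.Infinite := by
    refine infinite_of_mem_nhds (y 1) ((hM.preimage hcont).mem_nhds ?_)
    simpa using hy
  have hp : (Polynomial.C c * Polynomial.X ^ 3 + Polynomial.C (2 * b) * Polynomial.X ^ 2
      - Polynomial.C q : Polynomial ℝ) = 0 := by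
    refine Polynomial.eq_zero_of_infinite_isRoot _ (hinf.mono fun r hr => ?_)
    have h0 := hM1 _ hr
    have h1 := hc _ hr
    simp only [Function.update_self] at h0 h1
    rw [div_eq_iff (pow_ne_zero 3 h0)] at h1
    simp only [Polynomial.IsRoot, Set.mem_ofPred_eq, Polynomial.eval_sub, Polynomial.eval_add,
      Polynomial.eval_mul, Polynomial.eval_C, Polynomial.eval_pow, Polynomial.eval_X]
    linarith
  have e0 := congrArg (fun s => Polynomial.coeff s 0) hp
  have e2 := congrArg (fun s => Polynomial.coeff s 2) hp
  simp [Polynomial.coeff_X_pow, Polynomial.coeff_C, -map_mul] at e0 e2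
  exact hbq ⟨e2, e0⟩

section

variable (hV : IsOpen V) (hf : ContDiffOn ℝ ∞ f V) (hf0 : ∀ z ∈ V, f z ≠ 0)
  {x : Fin 4 → ℝ} (hx : x ∈ domain V)

include hV hf hf0 hx

/-- The Tachibana tensors `Q(g,R)`, `Q(g,C)`, `Q(S,R)`, `Q(S,C)` in terms of the two independent
tensors `Q(h, h ∧ p)` and `Q(p, h ∧ p)`. -/
theorem tachibana_all :
    let g := metric a b q f
    let h := radialField a b q x
    let p := fiberField f x
    let c₁ := coeffRadial q (x 1)
    let c₂ := coeffMixed b q (x 1)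
    let c₃ := coeffFiber a b q (x 1) (fiberF f x)
    let w := weylScalar a q (x 1) (fiberF f x)
    let s₁ := ricciRadial b (x 1)
    let s₂ := ricciFiber a b (x 1) (fiberF f x)
    tachibana (g x) (riemann g x) = (c₂ - 2 * c₁) • tachibana h (kn h p)
      + (c₂ - 2 * c₃) • tachibana p (kn h p) ∧
    tachibana (g x) (conformal g x) = (3 * w) • tachibana h (kn h p)
      + (3 * w) • tachibana p (kn h p) ∧
    tachibana (ricci g x) (riemann g x) = (s₁ * c₂ - 2 * s₂ * c₁) • tachibana h (kn h p)
      + (s₂ * c₂ - 2 * s₁ * c₃) • tachibana p (kn h p) ∧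
    tachibana (ricci g x) (conformal g x) = (w * (s₁ + 2 * s₂)) • tachibana h (kn h p)
      + (w * (s₂ + 2 * s₁)) • tachibana p (kn h p) := by
  intro g h p c₁ c₂ c₃ w s₁ s₂
  have s : IsSplitting (g x) h p := isSplitting_metric hf0 hx
  refine ⟨?_, ?_, ?_, ?_⟩
  · rw [riemann_block hV hf hf0 hx, s.tachibana_metric_blockTensor]
  · rw [conformal_block hV hf hf0 hx, s.tachibana_metric_blockTensor]
    module
  · rw [riemann_block hV hf hf0 hx, ricci_block hV hf hf0 hx, s.tachibana_blockTensor]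
  · rw [conformal_block hV hf hf0 hx, ricci_block hV hf hf0 hx, s.tachibana_blockTensor]
    module

theorem dot_riemann_sub_tachibana :
    let g := metric a b q f
    (x 1 ^ 3 * (2 * a * x 1 - 6 * q - fiberF f x * x 1)) •
        (dot (g x) (riemann g x) (riemann g x) - tachibana (ricci g x) (riemann g x))
      = (2 * (4 * a * q * x 1 + 4 * b ^ 2 * x 1 ^ 4 - 12 * b * q * x 1 ^ 2 - 3 * q ^ 2
        - 2 * q * fiberF f x * x 1)) • tachibana (g x) (conformal g x) := by
  intro g
  obtain ⟨t₁, t₂, t₃, -⟩ := tachibana_all (a := a) (b := b) (q := q) hV hf hf0 hx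
  obtain ⟨h₁, -⟩ := pseudosymmetric_all hV hf hf0 hx
    (riemann_block (a := a) (b := b) (q := q) hV hf hf0 hx)
  have hr := hx.1
  simp only [g]
  rw [h₁, t₁, t₂, t₃]
  match_scalars <;>
    simp only [coeffRadial, coeffMixed, coeffFiber, weylScalar, ricciRadial, ricciFiber] <;>
    field_simp <;> ring

theorem dot_commutator_riemann
    (h0 : 4 * q * x 1 * (a - 3 * b * x 1) + 4 * b ^ 2 * x 1 ^ 4 - 3 * q ^ 2
          - 2 * q * fiberF f x * x 1 ≠ 0) :
    let g := metric a b q f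
    dot (g x) (conformal g x) (riemann g x) - dot (g x) (riemann g x) (conformal g x) =
      (-((2 * a * x 1 - 6 * q - fiberF f x * x 1) *
            (2 * (a * q + 4 * b ^ 2 * x 1 ^ 3 - 6 * b * q * x 1) - q * fiberF f x) /
          (3 * x 1 ^ 2 * (4 * q * x 1 * (a - 3 * b * x 1) + 4 * b ^ 2 * x 1 ^ 4 - 3 * q ^ 2
            - 2 * q * fiberF f x * x 1)))) • tachibana (g x) (riemann g x) +
      ((q - 2 * b * x 1 ^ 2) * (-2 * a * x 1 + 6 * q + fiberF f x * x 1) /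
          (8 * q * x 1 * (3 * b * x 1 - a) - 8 * b ^ 2 * x 1 ^ 4 + 6 * q ^ 2
            + 4 * q * fiberF f x * x 1)) • tachibana (ricci g x) (riemann g x) := by
  intro g
  obtain ⟨t₁, t₂, t₃, -⟩ := tachibana_all (a := a) (b := b) (q := q) hV hf hf0 hx
  obtain ⟨-, -, h₁, -⟩ := pseudosymmetric_all hV hf hf0 hx
    (riemann_block (a := a) (b := b) (q := q) hV hf hf0 hx)
  obtain ⟨h₂, -⟩ := pseudosymmetric_all hV hf hf0 hx
    (conformal_block (a := a) (b := b) (q := q) hV hf hf0 hx)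
  have hr := hx.1
  -- The two denominators differ by the factor `-2`.
  have hd : 8 * q * x 1 * (3 * b * x 1 - a) - 8 * b ^ 2 * x 1 ^ 4 + 6 * q ^ 2
      + 4 * q * fiberF f x * x 1
      = -2 * (4 * q * x 1 * (a - 3 * b * x 1) + 4 * b ^ 2 * x 1 ^ 4 - 3 * q ^ 2
          - 2 * q * fiberF f x * x 1) := by ring
  simp only [g]
  rw [h₁, h₂, t₁, t₂, t₃, hd]
  generalize hDe : 4 * q * x 1 * (a - 3 * b * x 1) + 4 * b ^ 2 * x 1 ^ 4 - 3 * q ^ 2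
          - 2 * q * fiberF f x * x 1 = D at *
  match_scalars <;>
    simp only [coeffRadial, coeffMixed, coeffFiber, weylScalar, ricciRadial, ricciFiber] <;>
    field_simp <;> rw [← hDe] <;> ring

theorem dot_commutator_conformal :
    let g := metric a b q f
    dot (g x) (conformal g x) (riemann g x) - dot (g x) (riemann g x) (conformal g x) =
      (2 * (-2 * a + 12 * b * x 1 + fiberF f x) / (3 * x 1 ^ 2)) • tachibana (g x) (conformal g x) +
        (1 : ℝ) • tachibana (ricci g x) (conformal g x) := by
  intro g
  obtain ⟨t₁, t₂, -, t₄⟩ := tachibana_all (a := a) (b := b) (q := q) hV hf hf0 hx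
  obtain ⟨-, -, h₁, -⟩ := pseudosymmetric_all hV hf hf0 hx
    (riemann_block (a := a) (b := b) (q := q) hV hf hf0 hx)
  obtain ⟨h₂, -⟩ := pseudosymmetric_all hV hf hf0 hx
    (conformal_block (a := a) (b := b) (q := q) hV hf hf0 hx)
  have hr := hx.1
  simp only [g]
  rw [h₁, h₂, t₁, t₂, t₄]
  match_scalars <;>
    simp only [coeffRadial, coeffMixed, coeffFiber, weylScalar, ricciRadial, ricciFiber] <;>
    field_simp <;> ring

theorem riemann_roter (h0 : -2 * a + 4 * b * x 1 + fiberF f x ≠ 0) :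
    let g := metric a b q f
    riemann g x = (x 1 * (2 * a * x 1 - 6 * q - fiberF f x * x 1) /
          (2 * (-2 * a + 4 * b * x 1 + fiberF f x) ^ 2)) • kn (ricci g x) (ricci g x)
      + ((4 * a * b * x 1 ^ 2 + 6 * a * q + 8 * b ^ 2 * x 1 ^ 3
            - fiberF f x * (2 * b * x 1 ^ 2 + 3 * q) - 36 * b * q * x 1) /
          (x 1 * (-2 * a + 4 * b * x 1 + fiberF f x) ^ 2)) • kn (g x) (ricci g x)
      + (-(1 / x 1 ^ 3) *
          (-(4 * b * x 1 * (6 * a * q + 8 * b ^ 2 * x 1 ^ 3 - 24 * b * q * x 1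
              - 3 * q * fiberF f x) /
            (-2 * a + 4 * b * x 1 + fiberF f x) ^ 2) + q)) • kn (g x) (g x) := by
  intro g
  have hr := hx.1
  simp only [g]
  rw [riemann_block hV hf hf0 hx, ricci_block hV hf hf0 hx, metric_eq_add, kn_block,
    kn_metric_block, kn_metric_metric, smul_blockTensor, smul_blockTensor, smul_blockTensor,
    blockTensor_add, blockTensor_add]
  generalize hDe : -2 * a + 4 * b * x 1 + fiberF f x = D at *
  have hF : fiberF f x = D + 2 * a - 4 * b * x 1 := by linarith
  congr 1 <;>
    simp only [coeffRadial, coeffMixed, coeffFiber, ricciRadial, ricciFiber] <;>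
    rw [hF] <;> field_simp <;> ring

/-! ### The Ricci tensor -/

theorem ricci_components : ricci (metric a b q f) x =
    !![ricciRadial b (x 1) * lapse a b q (x 1), ricciRadial b (x 1), 0, 0;
      ricciRadial b (x 1), 0, 0, 0;
      0, 0, -(ricciFiber a b (x 1) (fiberF f x) * (x 1 ^ 2 / f (x 2, x 3) ^ 2)), 0;
      0, 0, 0, -(ricciFiber a b (x 1) (fiberF f x) * (x 1 ^ 2 / f (x 2, x 3) ^ 2))] := by
  rw [ricci_block hV hf hf0 hx]
  ext i j
  fin_cases i <;> fin_cases j <;>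
    simp [radialField, fiberField, radialBlock, fiberBlock, div_eq_mul_inv]

end

theorem metric_components (x : Fin 4 → ℝ) : metric a b q f x =
    !![lapse a b q (x 1), 1, 0, 0; 1, 0, 0, 0; 0, 0, -(x 1 ^ 2 / f (x 2, x 3) ^ 2), 0;
      0, 0, 0, -(x 1 ^ 2 / f (x 2, x 3) ^ 2)] := rfl

theorem metric_inv_components (hf0 : ∀ z ∈ V, f z ≠ 0) {x : Fin 4 → ℝ} (hx : x ∈ domain V) :
    (metric a b q f x)⁻¹ =
    !![0, 1, 0, 0; 1, -lapse a b q (x 1), 0, 0; 0, 0, -(f (x 2, x 3) ^ 2 / x 1 ^ 2), 0;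
      0, 0, 0, -(f (x 2, x 3) ^ 2 / x 1 ^ 2)] := by
  rw [metric_eq, block_inv (fiberEntry_ne_zero hf0 hx), invBlock]
  simp [div_eq_mul_inv, mul_comm]

/-- A rank criterion: `A` factors through `ℝ²`, and has rank `2` if it restricts to the identity
of `ℝ²` for suitable `P` and `Q`. -/
theorem rank_eq_two_of_factor {A : Matrix (Fin 4) (Fin 4) ℝ} {X : Matrix (Fin 4) (Fin 2) ℝ}
    {Y : Matrix (Fin 2) (Fin 4) ℝ} (h : A = X * Y) :
    A.rank ≤ 2 ∧ ∀ (P : Matrix (Fin 2) (Fin 4) ℝ) (Q : Matrix (Fin 4) (Fin 2) ℝ),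
      P * A * Q = 1 → A.rank = 2 := by
  have hle : A.rank ≤ 2 := by
    rw [h]
    exact (Matrix.rank_mul_le_left X Y).trans ((Matrix.rank_le_card_width X).trans (by simp))
  refine ⟨hle, fun P Q hPQ => le_antisymm hle ?_⟩
  have h1 : (P * A * Q).rank = 2 := by
    rw [hPQ, Matrix.rank_one]
    simp
  rw [← h1]
  exact (Matrix.rank_mul_le_left _ _).trans (Matrix.rank_mul_le_right _ _)

theorem rank_radialBlock (A c : ℝ) :
    (c • radialBlock A).rank ≤ 2 ∧ (c ≠ 0 → (c • radialBlock A).rank = 2) := by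
  have h : c • radialBlock A = !![(1 : ℝ), 0; 0, 1; 0, 0; 0, 0] * !![c * A, c, 0, 0; c, 0, 0, 0] := by
    ext i j
    fin_cases i <;> fin_cases j <;> simp [radialBlock, Matrix.mul_apply, Fin.sum_univ_two]
  refine ⟨(rank_eq_two_of_factor h).1, fun hc => (rank_eq_two_of_factor h).2
    !![0, c⁻¹, 0, 0; c⁻¹, -c⁻¹ * A, 0, 0] !![1, 0; 0, 1; 0, 0; 0, 0] ?_⟩
  ext i j
  fin_cases i <;> fin_cases j <;>
    simp [radialBlock, Matrix.mul_apply, Fin.sum_univ_four, hc]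
  field_simp
  ring

theorem rank_fiberBlock {B : ℝ} (hB : B ≠ 0) (c : ℝ) :
    (c • fiberBlock B).rank ≤ 2 ∧ (c ≠ 0 → (c • fiberBlock B).rank = 2) := by
  have h : c • fiberBlock B
      = !![(0 : ℝ), 0; 0, 0; 1, 0; 0, 1] * !![0, 0, -(c * B), 0; 0, 0, 0, -(c * B)] := by
    ext i j
    fin_cases i <;> fin_cases j <;> simp [fiberBlock, Matrix.mul_apply, Fin.sum_univ_two]
  refine ⟨(rank_eq_two_of_factor h).1, fun hc => (rank_eq_two_of_factor h).2
    !![0, 0, -(c * B)⁻¹, 0; 0, 0, 0, -(c * B)⁻¹] !![0, 0; 0, 0; 1, 0; 0, 1] ?_⟩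
  ext i j
  fin_cases i <;> fin_cases j <;>
    simp [fiberBlock, Matrix.mul_apply, Fin.sum_univ_four] <;> field_simp

section

variable (hV : IsOpen V) (hf : ContDiffOn ℝ ∞ f V) (hf0 : ∀ z ∈ V, f z ≠ 0)
  {x : Fin 4 → ℝ} (hx : x ∈ domain V)

include hV hf hf0 hx

theorem ricci_sub_smul_metric :
    ricci (metric a b q f) x - ((2 * a - 8 * b * x 1 - fiberF f x) / x 1 ^ 2) • metric a b q f x
      = ((-2 * a + 4 * b * x 1 + fiberF f x) / x 1 ^ 2) • radialField a b q x ∧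
    ricci (metric a b q f) x - (-(4 * b / x 1)) • metric a b q f x
      = (-(-2 * a + 4 * b * x 1 + fiberF f x) / x 1 ^ 2) • fiberField f x := by
  have hr := hx.1
  rw [ricci_block hV hf hf0 hx, metric_eq_add]
  constructor <;> match_scalars <;> simp only [ricciRadial, ricciFiber] <;> field_simp <;> ring

theorem rank_ricci_sub :
    let g := metric a b q f
    let A₁ := ricci g x - ((2 * a - 8 * b * x 1 - fiberF f x) / x 1 ^ 2) • g x
    let A₂ := ricci g x - (-(4 * b / x 1)) • g x
    A₁.rank ≤ 2 ∧ A₂.rank ≤ 2 ∧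
      (-2 * a + 4 * b * x 1 + fiberF f x ≠ 0 → A₁.rank = 2 ∧ A₂.rank = 2) := by
  intro g A₁ A₂
  obtain ⟨e₁, e₂⟩ := ricci_sub_smul_metric (a := a) (b := b) (q := q) hV hf hf0 hx
  have hr := hx.1
  have r₁ := rank_radialBlock (lapse a b q (x 1)) ((-2 * a + 4 * b * x 1 + fiberF f x) / x 1 ^ 2)
  have r₂ := rank_fiberBlock (fiberEntry_ne_zero hf0 hx)
    (-(-2 * a + 4 * b * x 1 + fiberF f x) / x 1 ^ 2)
  simp only [A₁, A₂, g, e₁, e₂]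
  exact ⟨r₁.1, r₂.1, fun h => ⟨r₁.2 (div_ne_zero h (pow_ne_zero 2 hr)),
    r₂.2 (div_ne_zero (neg_ne_zero.2 h) (pow_ne_zero 2 hr))⟩⟩

/-! ### Compatibility -/

theorem isCompatible_all {E : Matrix (Fin 4) (Fin 4) ℝ} (hE : E.IsSymm)
    (hEh : (E * (metric a b q f x)⁻¹ * radialField a b q x).IsSymm) :
    let g := metric a b q f
    IsCompatible (g x) (riemann g x) E ∧ IsCompatible (g x) (conformal g x) E ∧
      IsCompatible (g x) (concircular g x) E ∧ IsCompatible (g x) (conharmonic g x) E := by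
  intro g
  have s : IsSplitting (g x) (radialField a b q x) (fiberField f x) := isSplitting_metric hf0 hx
  refine ⟨?_, ?_, ?_, ?_⟩
  · rw [riemann_block hV hf hf0 hx]; exact s.isCompatible_blockTensor hE hEh _ _ _
  · rw [conformal_block hV hf hf0 hx]; exact s.isCompatible_blockTensor hE hEh _ _ _
  · rw [concircular_block hV hf hf0 hx]; exact s.isCompatible_blockTensor hE hEh _ _ _
  · rw [conharmonic_block hV hf hf0 hx]; exact s.isCompatible_blockTensor hE hEh _ _ _

theorem isCompatible_blockDiagonal (t₁₁ t₁₂ t₂₂ t₃₃ t₃₄ t₄₄ : ℝ) :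
    let E : Matrix (Fin 4) (Fin 4) ℝ :=
      !![t₁₁, t₁₂, 0, 0; t₁₂, t₂₂, 0, 0; 0, 0, t₃₃, t₃₄; 0, 0, t₃₄, t₄₄]
    let g := metric a b q f
    IsCompatible (g x) (riemann g x) E ∧ IsCompatible (g x) (conformal g x) E ∧
      IsCompatible (g x) (concircular g x) E ∧ IsCompatible (g x) (conharmonic g x) E := by
  intro E
  refine isCompatible_all hV hf hf0 hx ?_ ?_
  · ext i j
    fin_cases i <;> fin_cases j <;> rfl
  · have hδ : (metric a b q f x)⁻¹ * radialField a b q x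
        = !![1, 0, 0, 0; 0, 1, 0, 0; 0, 0, 0, 0; 0, 0, 0, 0] := by
      rw [metric_inv_components hf0 hx, radialField, radialBlock]
      ext i j
      fin_cases i <;> fin_cases j <;> simp [Matrix.mul_apply, Fin.sum_univ_four]
    rw [mul_assoc, hδ]
    ext i j
    fin_cases i <;> fin_cases j <;> simp [E, Matrix.mul_apply, Fin.sum_univ_four]

theorem isCompatible_ricci :
    let g := metric a b q f
    IsCompatible (g x) (riemann g x) (ricci g x) ∧
      IsCompatible (g x) (conformal g x) (ricci g x) ∧
      IsCompatible (g x) (concircular g x) (ricci g x) ∧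
      IsCompatible (g x) (conharmonic g x) (ricci g x) := by
  intro g
  have h := isCompatible_blockDiagonal (a := a) (b := b) (q := q) hV hf hf0 hx
    (ricciRadial b (x 1) * lapse a b q (x 1)) (ricciRadial b (x 1)) 0
    (-(ricciFiber a b (x 1) (fiberF f x) * (x 1 ^ 2 / f (x 2, x 3) ^ 2))) 0
    (-(ricciFiber a b (x 1) (fiberF f x) * (x 1 ^ 2 / f (x 2, x 3) ^ 2)))
  simp only [g]
  rw [← ricci_components hV hf hf0 hx] at h
  exact h

theorem isFormCompatible_single (i : Fin 4) (s : ℝ) :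
    let g := metric a b q f
    IsFormCompatible (g x) (riemann g x) (Pi.single i s) ∧
      IsFormCompatible (g x) (conformal g x) (Pi.single i s) := by
  intro g
  have h := isCompatible_blockDiagonal (a := a) (b := b) (q := q) hV hf hf0 hx
    (if i = 0 then s * s else 0) 0 (if i = 1 then s * s else 0) (if i = 2 then s * s else 0) 0
    (if i = 3 then s * s else 0)
  have e : Matrix.vecMulVec (Pi.single i s) (Pi.single i s)
      = !![if i = 0 then s * s else 0, 0, 0, 0; 0, if i = 1 then s * s else 0, 0, 0;
          0, 0, if i = 2 then s * s else 0, 0; 0, 0, 0, if i = 3 then s * s else 0] := by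
    ext j k
    fin_cases i <;> fin_cases j <;> fin_cases k <;> simp [Matrix.vecMulVec_apply]
  simp only [IsFormCompatible, e, g]
  exact ⟨h.1, h.2.1⟩

end

end

section

variable {a b q : ℝ} {f : ℝ × ℝ → ℝ} {V : Set (ℝ × ℝ)}

/-! ### Smoothness of the Roter coefficients -/

theorem contDiffOn_fiberF (hV : IsOpen V) (hf : ContDiffOn ℝ ∞ f V) {M : Set (Fin 4 → ℝ)}
    (hM : M ⊆ domain V) : ContDiffOn ℝ ∞ (fiberF f) M := by
  have hπ : ContDiff ℝ ∞ fun x : Fin 4 → ℝ => (x 2, x 3) := by fun_prop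
  exact ((contDiffOn_fiberCurv hV hf).comp hπ.contDiffOn fun x hx => (hM hx).2).congr
    fun x hx => fiberF_eq hV hf (hM hx)

/-- The coefficients of the Roter type decomposition are smooth. -/
theorem contDiffOn_roterCoeff {n : ℕ} (a b q : ℝ) {r F : (Fin n → ℝ) → ℝ} {M : Set (Fin n → ℝ)}
    (hr : ContDiffOn ℝ ∞ r M) (hF : ContDiffOn ℝ ∞ F M) (hr0 : ∀ x ∈ M, r x ≠ 0)
    (h : ∀ x ∈ M, -2 * a + 4 * b * r x + F x ≠ 0) :
    ContDiffOn ℝ ∞ (fun x => r x * (2 * a * r x - 6 * q - F x * r x) /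
        (2 * (-2 * a + 4 * b * r x + F x) ^ 2)) M ∧
    ContDiffOn ℝ ∞ (fun x => (4 * a * b * r x ^ 2 + 6 * a * q + 8 * b ^ 2 * r x ^ 3
          - F x * (2 * b * r x ^ 2 + 3 * q) - 36 * b * q * r x) /
        (r x * (-2 * a + 4 * b * r x + F x) ^ 2)) M ∧
    ContDiffOn ℝ ∞ (fun x => -(1 / r x ^ 3) *
        (-(4 * b * r x * (6 * a * q + 8 * b ^ 2 * r x ^ 3 - 24 * b * q * r x - 3 * q * F x) /
          (-2 * a + 4 * b * r x + F x) ^ 2) + q)) M := by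
  refine ⟨?_, ?_, ?_⟩
  · refine ContDiffOn.div (by fun_prop) (by fun_prop) fun x hx => ?_
    exact mul_ne_zero two_ne_zero (pow_ne_zero 2 (h x hx))
  · refine ContDiffOn.div (by fun_prop) (by fun_prop) fun x hx => ?_
    exact mul_ne_zero (hr0 x hx) (pow_ne_zero 2 (h x hx))
  · exact (ContDiffOn.div contDiffOn_const (by fun_prop)
      fun x hx => pow_ne_zero 3 (hr0 x hx)).neg.mul
        ((ContDiffOn.div (by fun_prop) (by fun_prop)
          fun x hx => pow_ne_zero 2 (h x hx)).neg.add contDiffOn_const)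

/-! ### Quasi-Einstein decompositions of the Ricci tensor -/

section

variable (hV : IsOpen V) (hf : ContDiffOn ℝ ∞ f V) (hf0 : ∀ z ∈ V, f z ≠ 0)
  {x : Fin 4 → ℝ} (hx : x ∈ domain V)

include hV hf hf0 hx in
theorem ricci_chaki {c : ℝ} (hc : c ≠ 0) (i j : Fin 4) :
    let η : Fin 4 → ℝ := ![c, 0, 0, 0]
    let θ : Fin 4 → ℝ := ![(q - a * x 1) / (c * x 1 ^ 3), 1 / (c * x 1 ^ 2), 0, 0]
    ricci (metric a b q f) x i j
      = -((-2 * a + 8 * b * x 1 + fiberF f x) / x 1 ^ 2) * metric a b q f x i j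
        + 4 * b * (-2 * a + 4 * b * x 1 + fiberF f x) / (c ^ 2 * x 1) * (η i * η j)
        + (-2 * a + 4 * b * x 1 + fiberF f x) * (η i * θ j + θ i * η j) := by
  have hr := hx.1
  have hφ := hf0 _ hx.2
  rw [ricci_components hV hf hf0 hx, metric_components]
  fin_cases i <;> fin_cases j <;> simp [ricciRadial, ricciFiber, lapse] <;> field_simp <;> ring

include hf0 hx in
theorem formInner_chaki {ψ : Scalar 4} (hc : ψ x ≠ 0) :
    let η : OneForm 4 := fun x => ![ψ x, 0, 0, 0]
    let θ : OneForm 4 := fun x =>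
      ![(q - a * x 1) / (ψ x * x 1 ^ 3), 1 / (ψ x * x 1 ^ 2), 0, 0]
    formInner (metric a b q f) η η x = 0 ∧
      formInner (metric a b q f) θ θ x = -(4 * b / (ψ x ^ 2 * x 1 ^ 3)) := by
  have hr := hx.1
  simp only [formInner, metric_inv_components hf0 hx]
  constructor
  · simp [Fin.sum_univ_four]
  · simp [Fin.sum_univ_four, lapse]
    field_simp
    ring

include hV hf hf0 hx in
theorem ricci_deGhosh (i j : Fin 4) :
    let η : Fin 4 → ℝ := ![0, 0, x 1 / f (x 2, x 3), 0]
    let θ : Fin 4 → ℝ := ![0, 0, 0, x 1 / f (x 2, x 3)]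
    ricci (metric a b q f) x i j
      = -(4 * b / x 1) * metric a b q f x i j
        + (-2 * a + 4 * b * x 1 + fiberF f x) / x 1 ^ 2 * (η i * η j)
        + (-2 * a + 4 * b * x 1 + fiberF f x) / x 1 ^ 2 * (θ i * θ j) := by
  have hr := hx.1
  have hφ := hf0 _ hx.2
  rw [ricci_components hV hf hf0 hx, metric_components]
  fin_cases i <;> fin_cases j <;> simp [ricciRadial, ricciFiber] <;> field_simp <;> ring

include hf0 hx in
theorem formInner_deGhosh :
    let η : OneForm 4 := fun x => ![0, 0, x 1 / f (x 2, x 3), 0]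
    let θ : OneForm 4 := fun x => ![0, 0, 0, x 1 / f (x 2, x 3)]
    formInner (metric a b q f) η η x = -1 ∧ formInner (metric a b q f) θ θ x = -1 ∧
      formInner (metric a b q f) η θ x = 0 := by
  have hr := hx.1
  have hφ := hf0 _ hx.2
  simp only [formInner, metric_inv_components hf0 hx]
  refine ⟨?_, ?_, ?_⟩ <;> simp [Fin.sum_univ_four] <;> field_simp

end

/-- The remainder `E = S - α g - β η ⊗ η`. -/
def ricciRemainder (g : MatrixField 4) (α β : Scalar 4) (η : OneForm 4) : MatrixField 4 :=
  fun x => Matrix.of fun i j => ricci g x i j - α x * g x i j - β x * (η x i * η x j)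

theorem hasQuasiEinsteinForm_ricciRemainder (M : Set (Fin 4 → ℝ)) (g : MatrixField 4)
    (α β : Scalar 4) (η : OneForm 4) :
    HasQuasiEinsteinForm M g α β (fun _ => 1) η (ricciRemainder g α β η) := by
  intro x _ i j
  simp only [ricciRemainder, Matrix.of_apply]
  ring

theorem isPseudoQuasiEinstein_metric (hV : IsOpen V) (hf : ContDiffOn ℝ ∞ f V)
    (hf0 : ∀ z ∈ V, f z ≠ 0) {M : Set (Fin 4 → ℝ)} (hM : M ⊆ domain V) :
    IsPseudoQuasiEinstein M (metric a b q f)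
      (fun x => (2 * a - 16 * b * x 1 - fiberF f x) / (3 * x 1 ^ 2))
      (fun x => 2 * (-2 * a + 4 * b * x 1 + fiberF f x) / (3 * x 1 ^ 2))
      (fun _ => 1) (fun x => ![0, 0, 0, x 1 / f (x 2, x 3)]) := by
  refine ⟨_, hasQuasiEinsteinForm_ricciRemainder _ _ _ _ _, fun x hx => ?_, fun x hx i => ?_⟩
  all_goals
    have hr := (hM hx).1
    have hφ := hf0 _ (hM hx).2
    simp only [ricciRemainder, ricci_components hV hf hf0 (hM hx),
      metric_inv_components hf0 (hM hx)]
    simp only [metric_components, Fin.sum_univ_four]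
  · simp [ricciRadial, ricciFiber]
    field_simp
    ring
  · fin_cases i <;> simp [ricciRadial, ricciFiber]
    left
    field_simp
    ring

theorem exists_traceFree_metric (hV : IsOpen V) (hf : ContDiffOn ℝ ∞ f V)
    (hf0 : ∀ z ∈ V, f z ≠ 0) {M : Set (Fin 4 → ℝ)} (hM : M ⊆ domain V) :
    ∃ E : MatrixField 4,
      HasQuasiEinsteinForm M (metric a b q f) (fun x => -(fiberF f x / (2 * x 1 ^ 2)))
        (fun x => -(4 * (a - 6 * b * x 1) / x 1 ^ 2)) (fun _ => 1)
        (fun x => ![0, 0, 0, x 1 / f (x 2, x 3)]) E ∧ IsTraceFree M (metric a b q f) E := by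
  refine ⟨_, hasQuasiEinsteinForm_ricciRemainder _ _ _ _ _, fun x hx => ?_⟩
  have hr := (hM hx).1
  have hφ := hf0 _ (hM hx).2
  simp only [ricciRemainder, ricci_components hV hf hf0 (hM hx),
    metric_inv_components hf0 (hM hx)]
  simp only [metric_components, Fin.sum_univ_four]
  simp [ricciRadial, ricciFiber]
  field_simp
  ring

end

end RT

end

theorem theorem4p1
    (a b q : ℝ) (f : ℝ × ℝ → ℝ) (V : Set (ℝ × ℝ)) (hV : IsOpen V)
    (hf : ContDiffOn ℝ ∞ f V) (hf0 : ∀ p ∈ V, f p ≠ 0)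
    (M : Set (Fin 4 → ℝ)) (hM : IsOpen M) (hne : M.Nonempty)
    (hMV : ∀ x ∈ M, x 1 ≠ 0 ∧ (x 2, x 3) ∈ V) :
    let g : RT.MatrixField 4 := RT.metric a b q f
    let R : RT.TensorField 4 4 := RT.riemann g
    let S : RT.MatrixField 4 := RT.ricci g
    let S₂ : RT.TensorField 4 2 := fun x => RT.tensorOfMatrix (S x)
    let C : RT.TensorField 4 4 := RT.conformal g
    let P : RT.TensorField 4 4 := RT.projective g
    let W : RT.TensorField 4 4 := RT.concircular g
    let K : RT.TensorField 4 4 := RT.conharmonic g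
    let r : RT.Scalar 4 := fun x => x 1
    let F : RT.Scalar 4 := RT.fiberF f
    let F₃ : RT.Scalar 4 := RT.pd 2 F
    let F₄ : RT.Scalar 4 := RT.pd 3 F
    let φ : RT.Scalar 4 := fun x => f (x 2, x 3)
    let LR : RT.Scalar 4 := fun x => (q - 2 * b * r x ^ 2) / r x ^ 3
    let LC : RT.Scalar 4 := fun x => -((2 * a * r x - 6 * q - F x * r x) / (6 * r x ^ 3))
    -- pseudosymmetry
    (RT.IsPseudosymmetric M g R R LR ∧ RT.IsPseudosymmetric M g R S₂ LR ∧
      RT.IsPseudosymmetric M g R C LR ∧ RT.IsPseudosymmetric M g R P LR ∧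
      RT.IsPseudosymmetric M g R W LR ∧ RT.IsPseudosymmetric M g R K LR ∧
      (¬(b = 0 ∧ q = 0) → ¬∃ c : ℝ, ∀ x ∈ M, LR x = c)) ∧
    -- R·R - Q(S,R) and Q(g,C)
    (∀ x ∈ M,
      (r x ^ 3 * (2 * a * r x - 6 * q - F x * r x)) •
          (RT.dot (g x) (R x) (R x) - RT.tachibana (S x) (R x)) =
        (2 * (4 * a * q * r x + 4 * b ^ 2 * r x ^ 4 - 12 * b * q * r x ^ 2 - 3 * q ^ 2
          - 2 * q * F x * r x)) • RT.tachibana (g x) (C x)) ∧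
    -- C·H = L Q(g,H)
    (RT.IsPseudosymmetric M g C R LC ∧ RT.IsPseudosymmetric M g C S₂ LC ∧
      RT.IsPseudosymmetric M g C C LC ∧ RT.IsPseudosymmetric M g C W LC ∧
      RT.IsPseudosymmetric M g C P LC ∧ RT.IsPseudosymmetric M g C K LC) ∧
    -- C·R - R·C through Q(g,R) and Q(S,R)
    ((∀ x ∈ M, 4 * q * r x * (a - 3 * b * r x) + 4 * b ^ 2 * r x ^ 4 - 3 * q ^ 2
          - 2 * q * F x * r x ≠ 0) →
      ∀ x ∈ M,
        RT.dot (g x) (C x) (R x) - RT.dot (g x) (R x) (C x) =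
          (-((2 * a * r x - 6 * q - F x * r x) *
                (2 * (a * q + 4 * b ^ 2 * r x ^ 3 - 6 * b * q * r x) - q * F x) /
              (3 * r x ^ 2 * (4 * q * r x * (a - 3 * b * r x) + 4 * b ^ 2 * r x ^ 4 - 3 * q ^ 2
                - 2 * q * F x * r x)))) • RT.tachibana (g x) (R x) +
          ((q - 2 * b * r x ^ 2) * (-2 * a * r x + 6 * q + F x * r x) /
              (8 * q * r x * (3 * b * r x - a) - 8 * b ^ 2 * r x ^ 4 + 6 * q ^ 2
                + 4 * q * F x * r x)) • RT.tachibana (S x) (R x)) ∧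
    -- C·R - R·C through Q(g,C) and Q(S,C)
    (∀ x ∈ M,
      RT.dot (g x) (C x) (R x) - RT.dot (g x) (R x) (C x) =
        (2 * (-2 * a + 12 * b * r x + F x) / (3 * r x ^ 2)) • RT.tachibana (g x) (C x) +
          (1 : ℝ) • RT.tachibana (S x) (C x)) ∧
    -- recurrence of the conformal curvature 2-forms
    ((∀ x ∈ M, -2 * a * r x + 6 * q + F x * r x ≠ 0) →
      let η : RT.OneForm 4 := fun x =>
        ![0, (F x - 2 * a) / (-2 * a * r x + 6 * q + F x * r x),
          F₃ x * r x / (-2 * a * r x + 6 * q + F x * r x),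
          F₄ x * r x / (-2 * a * r x + 6 * q + F x * r x)]
      RT.IsRecurrentForm M g C η ∧ RT.SatisfiesCyclicRecurrence M g C η) ∧
    -- Roter type
    ((∀ x ∈ M, -2 * a + 4 * b * r x + F x ≠ 0) →
      RT.IsRoterType M g
        (fun x => r x * (2 * a * r x - 6 * q - F x * r x) /
          (2 * (-2 * a + 4 * b * r x + F x) ^ 2))
        (fun x => (4 * a * b * r x ^ 2 + 6 * a * q + 8 * b ^ 2 * r x ^ 3
            - F x * (2 * b * r x ^ 2 + 3 * q) - 36 * b * q * r x) /
          (r x * (-2 * a + 4 * b * r x + F x) ^ 2))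
        (fun x => -(1 / r x ^ 3) *
          (-(4 * b * r x * (6 * a * q + 8 * b ^ 2 * r x ^ 3 - 24 * b * q * r x - 3 * q * F x) /
            (-2 * a + 4 * b * r x + F x) ^ 2) + q))) ∧
    -- 2-quasi-Einstein
    (let α₁ : RT.Scalar 4 := fun x => (2 * a - 8 * b * r x - F x) / r x ^ 2
     let α₂ : RT.Scalar 4 := fun x => -(4 * b / r x)
     RT.IsTwoQuasiEinstein M g α₁ ∧ RT.IsTwoQuasiEinstein M g α₂ ∧
      ∀ x ∈ M, -2 * a + 4 * b * r x + F x ≠ 0 →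
        (S x - α₁ x • g x).rank = 2 ∧ (S x - α₂ x • g x).rank = 2) ∧
    -- generalized quasi-Einstein in the sense of Chaki
    (∀ φ₁ : RT.Scalar 4, (∀ x ∈ M, φ₁ x ≠ 0) →
      let η : RT.OneForm 4 := fun x => ![φ₁ x, 0, 0, 0]
      let θ : RT.OneForm 4 := fun x =>
        ![(q - a * r x) / (φ₁ x * r x ^ 3), 1 / (φ₁ x * r x ^ 2), 0, 0]
      RT.IsChakiQuasiEinstein M g
        (fun x => -((-2 * a + 8 * b * r x + F x) / r x ^ 2))
        (fun x => 4 * b * (-2 * a + 4 * b * r x + F x) / (φ₁ x ^ 2 * r x))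
        (fun x => -2 * a + 4 * b * r x + F x) η θ ∧
      (∀ x ∈ M, RT.formInner g η η x = 0 ∧
        RT.formInner g θ θ x = -(4 * b / (φ₁ x ^ 2 * r x ^ 3)))) ∧
    -- generalized quasi-Einstein in the sense of De and Ghosh
    (let η : RT.OneForm 4 := fun x => ![0, 0, r x / φ x, 0]
     let θ : RT.OneForm 4 := fun x => ![0, 0, 0, r x / φ x]
     RT.IsDeGhoshQuasiEinstein M g
        (fun x => -(4 * b / r x))
        (fun x => (-2 * a + 4 * b * r x + F x) / r x ^ 2)
        (fun x => (-2 * a + 4 * b * r x + F x) / r x ^ 2) η θ ∧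
      (∀ x ∈ M, RT.formInner g η η x = -1 ∧ RT.formInner g θ θ x = -1 ∧
        RT.formInner g η θ x = 0)) ∧
    -- pseudo quasi-Einstein
    (let η : RT.OneForm 4 := fun x => ![0, 0, 0, r x / φ x]
     RT.IsPseudoQuasiEinstein M g
        (fun x => (2 * a - 16 * b * r x - F x) / (3 * r x ^ 2))
        (fun x => 2 * (-2 * a + 4 * b * r x + F x) / (3 * r x ^ 2))
        (fun _ => 1) η ∧
      ∃ E : RT.MatrixField 4,
        RT.HasQuasiEinsteinForm M g (fun x => -(F x / (2 * r x ^ 2)))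
          (fun x => -(4 * (a - 6 * b * r x) / r x ^ 2)) (fun _ => 1) η E ∧
        RT.IsTraceFree M g E) ∧
    -- compatible tensors and 1-forms
    (∀ x ∈ M,
      (∀ t₁₁ t₁₂ t₂₂ t₃₃ t₃₄ t₄₄ : ℝ,
        let E : Matrix (Fin 4) (Fin 4) ℝ :=
          !![t₁₁, t₁₂, 0, 0; t₁₂, t₂₂, 0, 0; 0, 0, t₃₃, t₃₄; 0, 0, t₃₄, t₄₄]
        RT.IsCompatible (g x) (R x) E ∧ RT.IsCompatible (g x) (C x) E ∧
          RT.IsCompatible (g x) (W x) E ∧ RT.IsCompatible (g x) (K x) E) ∧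
      (RT.IsCompatible (g x) (R x) (S x) ∧ RT.IsCompatible (g x) (C x) (S x) ∧
        RT.IsCompatible (g x) (W x) (S x) ∧ RT.IsCompatible (g x) (K x) (S x)) ∧
      (∀ (i : Fin 4) (s : ℝ),
        RT.IsFormCompatible (g x) (R x) (Pi.single i s) ∧
          RT.IsFormCompatible (g x) (C x) (Pi.single i s))) := by 
  intro g R S S₂ C P W K r F F₃ F₄ φ LR LC
  have hsub : M ⊆ RT.domain V := hMV
  refine ⟨⟨?_, ?_, ?_, ?_, ?_, ?_, ?_⟩, ?_, ⟨?_, ?_, ?_, ?_, ?_, ?_⟩, ?_, ?_, ?_, ?_, ?_, ?_, ?_,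
    ?_, ?_⟩
  · exact fun x hx => (RT.pseudosymmetric_all hV hf hf0 (hsub hx)
      (RT.riemann_block hV hf hf0 (hsub hx))).1
  · exact fun x hx => (RT.pseudosymmetric_all hV hf hf0 (hsub hx)
      (RT.riemann_block hV hf hf0 (hsub hx))).2.1
  · exact fun x hx => (RT.pseudosymmetric_all hV hf hf0 (hsub hx)
      (RT.riemann_block hV hf hf0 (hsub hx))).2.2.1
  · exact fun x hx => (RT.pseudosymmetric_all hV hf hf0 (hsub hx)
      (RT.riemann_block hV hf hf0 (hsub hx))).2.2.2.1
  · exact fun x hx => (RT.pseudosymmetric_all hV hf hf0 (hsub hx)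
      (RT.riemann_block hV hf hf0 (hsub hx))).2.2.2.2.1
  · exact fun x hx => (RT.pseudosymmetric_all hV hf hf0 (hsub hx)
      (RT.riemann_block hV hf hf0 (hsub hx))).2.2.2.2.2
  · exact RT.coeffMixed_not_constant hM hne fun x hx => (hMV x hx).1
  · exact fun x hx => RT.dot_riemann_sub_tachibana hV hf hf0 (hsub hx)
  · exact fun x hx => (RT.pseudosymmetric_all hV hf hf0 (hsub hx)
      (RT.conformal_block hV hf hf0 (hsub hx))).1
  · exact fun x hx => (RT.pseudosymmetric_all hV hf hf0 (hsub hx)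
      (RT.conformal_block hV hf hf0 (hsub hx))).2.1
  · exact fun x hx => (RT.pseudosymmetric_all hV hf hf0 (hsub hx)
      (RT.conformal_block hV hf hf0 (hsub hx))).2.2.1
  · exact fun x hx => (RT.pseudosymmetric_all hV hf hf0 (hsub hx)
      (RT.conformal_block hV hf hf0 (hsub hx))).2.2.2.2.1
  · exact fun x hx => (RT.pseudosymmetric_all hV hf hf0 (hsub hx)
      (RT.conformal_block hV hf hf0 (hsub hx))).2.2.2.1
  · exact fun x hx => (RT.pseudosymmetric_all hV hf hf0 (hsub hx)
      (RT.conformal_block hV hf hf0 (hsub hx))).2.2.2.2.2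
  · exact fun h x hx => RT.dot_commutator_riemann hV hf hf0 (hsub hx) (h x hx)
  · exact fun x hx => RT.dot_commutator_conformal hV hf hf0 (hsub hx)
  · exact RT.conformal_cyclicRecurrence hV hf hf0 hsub
  · intro h
    have hr : ContDiffOn ℝ ∞ r M := (contDiff_apply ℝ ℝ (1 : Fin 4)).contDiffOn
    have hF : ContDiffOn ℝ ∞ F M := RT.contDiffOn_fiberF hV hf hsub
    have hr0 : ∀ x ∈ M, r x ≠ 0 := fun x hx => (hMV x hx).1
    obtain ⟨h₁, h₂, h₃⟩ := RT.contDiffOn_roterCoeff a b q hr hF hr0 h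
    exact ⟨h₁, h₂, h₃, fun x hx => RT.riemann_roter hV hf hf0 (hsub hx) (h x hx)⟩
  · exact ⟨fun x hx => (RT.rank_ricci_sub hV hf hf0 (hsub hx)).1,
      fun x hx => (RT.rank_ricci_sub hV hf hf0 (hsub hx)).2.1,
      fun x hx => (RT.rank_ricci_sub hV hf hf0 (hsub hx)).2.2⟩
  · exact fun φ₁ hφ₁ => ⟨fun x hx i j => RT.ricci_chaki hV hf hf0 (hsub hx) (hφ₁ x hx) i j,
      fun x hx => RT.formInner_chaki hf0 (hsub hx) (hφ₁ x hx)⟩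
  · exact ⟨fun x hx i j => RT.ricci_deGhosh hV hf hf0 (hsub hx) i j,
      fun x hx => RT.formInner_deGhosh hf0 (hsub hx)⟩
  · exact ⟨RT.isPseudoQuasiEinstein_metric hV hf hf0 hsub,
      RT.exists_traceFree_metric hV hf hf0 hsub⟩
  · exact fun x hx => ⟨RT.isCompatible_blockDiagonal hV hf hf0 (hsub hx),
      RT.isCompatible_ricci hV hf hf0 (hsub hx), RT.isFormCompatible_single hV hf hf0 (hsub hx)⟩
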